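/- Let $M$ be a smooth four-dimensional manifold with a smooth pseudo-Riemannian (for instance Lorentzian) metric $g_{kl}$, Levi-Civita connection $\nabla$, Riemann tensor $R_{jklm}$, Ricci tensor $R_{kl}=R^{p}{}_{kpl}$ where $R^a{}_{bcd}=\partial_c\Gamma^a_{db}-\partial_d\Gamma^a_{cb}+\Gamma^a_{ce}\Gamma^e_{db}-\Gamma^a_{de}\Gamma^e_{cb}$, scalar curvature $R$ and Einstein tensor $G_{kl}=R_{kl}-\frac12 R g_{kl}$. Define Harada's tensor $$H_{jkl}=\nabla_jR_{kl}+\nabla_kR_{lj}+\nabla_lR_{jk}-\tfrac13\left(g_{kl}\nabla_jR+g_{lj}\nabla_kR+g_{jk}\nabla_lR\right)$$ and $$\Phi_{kl}=g_{kl}\left(\tfrac12G_{pq}G^{pq}-\tfrac16R^2+\tfrac12\nabla^2R\right)+4R_{jklm}G^{mj}+2G_{km}G_l{}^m+\tfrac43RG_{kl}.$$ Then: 1. $\nabla^k\nabla^jH_{jkl}=\nabla^k\Phi_{kl}$ for every such metric. 2. If $g$ is a vacuum solution of conformal Killing gravity, i.e. $H_{jkl}=0$ on $M$, then $\nabla^k\Phi_{kl}=0$,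 and for every smooth Killing vector field $\xi$ (i.e. $\nabla_i\xi_j+\nabla_j\xi_i=0$) the current $J_k=\Phi_{kl}\xi^l$ is conserved: $\nabla^k(\Phi_{kl}\xi^l)=0$. 3. If $g$ is Einstein, i.e. $R_{jm}=\frac14Rg_{jm}$ on $M$, then $\Phi_{kl}=0$ on $M$. -/

import Mathlib

open scoped Manifold ContDiff

noncomputable section

namespace CKG

/-! ### Tensor calculus in a coordinate chart of dimension four -/

/-- The coordinate space `ℝ⁴`. -/
abbrev Coord : Type := EuclideanSpace ℝ (Fin 4)

/-- The components `T_{a₀ … a₍ₙ₋₁₎}(x)` of a covariant tensor field of rank `n` in coordinates. -/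
abbrev TensorField (n : ℕ) : Type := (Fin n → Fin 4) → Coord → ℝ

/-- The components `g_{ij}(x)` of a metric in coordinates. -/
abbrev MetricField : Type := Coord → Matrix (Fin 4) (Fin 4) ℝ

/-- The partial derivative `∂_i f`. -/
def pd (i : Fin 4) (f : Coord → ℝ) (x : Coord) : ℝ :=
  fderiv ℝ f x (EuclideanSpace.single i 1)

/-- The Christoffel symbols `Γ^k_{ij} = ½ g^{kl} (∂_i g_{jl} + ∂_j g_{il} - ∂_l g_{ij})`
of the Levi-Civita connection; `(g x)⁻¹ k l` is `g^{kl}`. -/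
def christoffel (g : MetricField) (k i j : Fin 4) (x : Coord) : ℝ :=
  ∑ l, (1 / 2 : ℝ) * (g x)⁻¹ k l *
    (pd i (fun y => g y j l) x + pd j (fun y => g y i l) x - pd l (fun y => g y i j) x)

/-- The Levi-Civita covariant derivative `∇_i T_{a₀ … a₍ₙ₋₁₎}` of a covariant tensor field;
the derivative index `i` is placed first. -/
def covDeriv (g : MetricField) {n : ℕ} (T : TensorField n) : TensorField (n + 1) :=
  fun b x => pd (b 0) (T (Fin.tail b)) x -
    ∑ s : Fin n, ∑ m, christoffel g m (b 0) (Fin.tail b s) x *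
      T (Function.update (Fin.tail b) s m) x

/-- The divergence on the first index: `∇^q T_{q a₁ … aₙ} = g^{pq} ∇_p T_{q a₁ … aₙ}`. -/
def divergence (g : MetricField) {n : ℕ} (T : TensorField (n + 1)) : TensorField n :=
  fun a x => ∑ p, ∑ q, (g x)⁻¹ p q * covDeriv g T (Fin.cons p (Fin.cons q a)) x

/-- The curvature components
`R^a_{bcd} = ∂_c Γ^a_{db} - ∂_d Γ^a_{cb} + Γ^a_{ce} Γ^e_{db} - Γ^a_{de} Γ^e_{cb}`. -/
def riemannUp (g : MetricField) (a b c d : Fin 4) (x : Coord) : ℝ :=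
  pd c (christoffel g a d b) x - pd d (christoffel g a c b) x +
    ∑ e, (christoffel g a c e x * christoffel g e d b x -
      christoffel g a d e x * christoffel g e c b x)

/-- The Riemann tensor `R_{abcd} = g_{ae} R^e_{bcd}`. -/
def riemann (g : MetricField) (a b c d : Fin 4) (x : Coord) : ℝ :=
  ∑ e, g x a e * riemannUp g e b c d x

/-- The Ricci tensor `R_{kl} = R^p_{kpl}`. -/
def ricci (g : MetricField) : TensorField 2 :=
  fun a x => ∑ p, riemannUp g p (a 0) p (a 1) x

/-- The curvature scalar `R = g^{kl} R_{kl}`. -/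
def scalarCurv (g : MetricField) (x : Coord) : ℝ :=
  ∑ k, ∑ l, (g x)⁻¹ k l * ricci g ![k, l] x

/-- The gradient `∇_j f` of a scalar field. -/
def grad (f : Coord → ℝ) : TensorField 1 :=
  fun a x => pd (a 0) f x

/-- The Laplacian `∇² f = ∇^k ∇_k f`. -/
def laplacian (g : MetricField) (f : Coord → ℝ) (x : Coord) : ℝ :=
  divergence g (grad f) ![] x

/-- The Einstein tensor `G_{kl} = R_{kl} - ½ R g_{kl}`. -/
def einstein (g : MetricField) : TensorField 2 :=
  fun a x => ricci g a x - (1 / 2 : ℝ) * scalarCurv g x * g x (a 0) (a 1)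

/-- The mixed components `G_l^m = g^{mp} G_{lp}`. -/
def einsteinMixed (g : MetricField) (l m : Fin 4) (x : Coord) : ℝ :=
  ∑ p, (g x)⁻¹ m p * einstein g ![l, p] x

/-- The contravariant components `G^{mj} = g^{mp} g^{jq} G_{pq}`. -/
def einsteinUp (g : MetricField) (m j : Fin 4) (x : Coord) : ℝ :=
  ∑ p, ∑ q, (g x)⁻¹ m p * (g x)⁻¹ j q * einstein g ![p, q] x

/-- Harada's tensor
`H_{jkl} = ∇_j R_{kl} + ∇_k R_{lj} + ∇_l R_{jk} - ⅓ (g_{kl} ∇_j R + g_{lj} ∇_k R + g_{jk} ∇_l R)`,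
where `(j, k, l) = (a 0, a 1, a 2)`. -/
def harada (g : MetricField) : TensorField 3 :=
  fun a x =>
    covDeriv g (ricci g) ![a 0, a 1, a 2] x + covDeriv g (ricci g) ![a 1, a 2, a 0] x +
      covDeriv g (ricci g) ![a 2, a 0, a 1] x -
    (1 / 3 : ℝ) * (g x (a 1) (a 2) * grad (scalarCurv g) ![a 0] x +
      g x (a 2) (a 0) * grad (scalarCurv g) ![a 1] x +
      g x (a 0) (a 1) * grad (scalarCurv g) ![a 2] x)

/-- The tensor
`Φ_{kl} = g_{kl} (½ G_{pq} G^{pq} - ⅙ R² + ½ ∇² R) + 4 R_{jklm} G^{mj} + 2 G_{km} G_l^m + (4/3) R G_{kl}`,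
where `(k, l) = (a 0, a 1)`. -/
def phi (g : MetricField) : TensorField 2 :=
  fun a x =>
    g x (a 0) (a 1) *
      ((1 / 2 : ℝ) * (∑ p, ∑ q, einstein g ![p, q] x * einsteinUp g p q x) -
        (1 / 6 : ℝ) * scalarCurv g x ^ 2 + (1 / 2 : ℝ) * laplacian g (scalarCurv g) x) +
    4 * (∑ j, ∑ m, riemann g j (a 0) (a 1) m x * einsteinUp g m j x) +
    2 * (∑ m, einstein g ![a 0, m] x * einsteinMixed g (a 1) m x) +
    (4 / 3 : ℝ) * scalarCurv g x * einstein g ![a 0, a 1] x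

/-- The covariant components `ξ_j = g_{jl} ξ^l` of a vector field. -/
def lower (g : MetricField) (ξ : Fin 4 → Coord → ℝ) : TensorField 1 :=
  fun a x => ∑ l, g x (a 0) l * ξ l x

/-- The current `J_k = Φ_{kl} ξ^l`. -/
def current (g : MetricField) (ξ : Fin 4 → Coord → ℝ) : TensorField 1 :=
  fun a x => ∑ l, phi g ![a 0, l] x * ξ l x

/-! ### Metrics and vector fields on a four-dimensional manifold -/

section Manifold

attribute [local instance 2000] chartedSpaceSelf

variable {M : Type*} [TopologicalSpace M] [ChartedSpace Coord M]

/-- The coordinate vector `∂/∂xⁱ` of the chart `e`, at the point with coordinates `x`. -/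
def coordVec (e : OpenPartialHomeomorph M Coord) (i : Fin 4) (x : Coord) :
    TangentSpace (𝓡 4) (e.symm x) :=
  mfderiv (𝓡 4) (𝓡 4) e.symm x (EuclideanSpace.single i (1 : ℝ) : Coord)

/-- The components `ξⁱ` of a vector field in the chart `e`, as functions of the coordinates. -/
def vecComp (ξ : ∀ p : M, TangentSpace (𝓡 4) p) (e : OpenPartialHomeomorph M Coord)
    (i : Fin 4) (x : Coord) : ℝ :=
  let v : Coord := mfderiv (𝓡 4) (𝓡 4) e (e.symm x) (ξ (e.symm x))
  v i

variable (M) in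
/-- A smooth pseudo-Riemannian metric, of arbitrary signature, on a smooth four-manifold. -/
structure PseudoRiemannianMetric [IsManifold (𝓡 4) ∞ M] where
  /-- The bilinear form on each tangent space. -/
  inner (p : M) : TangentSpace (𝓡 4) p →L[ℝ] TangentSpace (𝓡 4) p →L[ℝ] ℝ
  symm (p : M) (v w : TangentSpace (𝓡 4) p) : inner p v w = inner p w v
  nondegenerate (p : M) (v : TangentSpace (𝓡 4) p) (hv : ∀ w, inner p v w = 0) : v = 0
  contMDiff : ContMDiff (𝓡 4) ((𝓡 4).prod 𝓘(ℝ, Coord →L[ℝ] Coord →L[ℝ] ℝ)) ∞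
    (fun p : M => Bundle.TotalSpace.mk' (Coord →L[ℝ] Coord →L[ℝ] ℝ)
      (E := fun p : M => TangentSpace (𝓡 4) p →L[ℝ] TangentSpace (𝓡 4) p →L[ℝ] ℝ) p (inner p))

variable [IsManifold (𝓡 4) ∞ M]

namespace PseudoRiemannianMetric

/-- The components `g_{ij} = g(∂_i, ∂_j)` of the metric in the chart `e`. -/
def comp (g : PseudoRiemannianMetric M) (e : OpenPartialHomeomorph M Coord) : MetricField :=
  fun x => Matrix.of fun i j => g.inner (e.symm x) (coordVec e i x) (coordVec e j x)

/-- The vacuum field equations `H_{jkl} = 0` of conformal Killing gravity. -/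
def IsVacuumCKG (g : PseudoRiemannianMetric M) : Prop :=
  ∀ e ∈ IsManifold.maximalAtlas (𝓡 4) ∞ M, ∀ x ∈ e.target, ∀ j k l : Fin 4,
    harada (g.comp e) ![j, k, l] x = 0

/-- Einstein metrics: `R_{jm} = ¼ R g_{jm}`. -/
def IsEinstein (g : PseudoRiemannianMetric M) : Prop :=
  ∀ e ∈ IsManifold.maximalAtlas (𝓡 4) ∞ M, ∀ x ∈ e.target, ∀ j m : Fin 4,
    ricci (g.comp e) ![j, m] x = (1 / 4 : ℝ) * scalarCurv (g.comp e) x * g.comp e x j m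

/-- Killing vector fields: smooth, with `∇_i ξ_j + ∇_j ξ_i = 0`. -/
structure IsKilling (g : PseudoRiemannianMetric M) (ξ : ∀ p : M, TangentSpace (𝓡 4) p) :
    Prop where
  contMDiff : ContMDiff (𝓡 4) (𝓡 4).tangent ∞ (fun p => (⟨p, ξ p⟩ : TangentBundle (𝓡 4) M))
  killing : ∀ e ∈ IsManifold.maximalAtlas (𝓡 4) ∞ M, ∀ x ∈ e.target, ∀ i j : Fin 4,
    covDeriv (g.comp e) (lower (g.comp e) (vecComp ξ e)) ![i, j] x +
      covDeriv (g.comp e) (lower (g.comp e) (vecComp ξ e)) ![j, i] x = 0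

end PseudoRiemannianMetric

end Manifold

end CKG

end

noncomputable section

namespace CKG

/-! ### Partial derivatives -/

section PartialDerivatives

variable {U : Set Coord} {f f' : Coord → ℝ} {x : Coord}

/-! Every assertion concerns components in one chart, so the work takes place on an open subset of
`ℝ⁴` carrying a smooth symmetric nondegenerate matrix field (`IsMetricOn`). `isMetricOn_comp` shows
that a chart of the maximal atlas supplies such data.

The identity of part 1 is a commutation of covariant derivatives combined with the Bianchi
identities. Put W_{kl} = ∇^j∇_k R_{jl}. The divergence of H is ∇²R_{kl} + W_{kl} + W_{lk} -
⅓(g_{kl}∇²R + 2∇_k∇_l R). By the Ricci identity and ∇^jR_{jl} = ½∇_l R, W_{kl} = ½∇_k∇_l R +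
R_{km}R_l^m + R_{jklm}R^{mj} (`divCovDerivRicci_eq`), which is symmetric. One more commutation gives
∇^k∇²R_{kl} = ∇^kW_{kl} + R_{jklm}∇^kR^{mj} (`div_laplacian_ricci`). Hence the double divergence is
3∇^kW_{kl} + R_{jklm}∇^kR^{mj} plus derivatives of R.

On the other side, `phi_eq` rewrites Φ with Ric in place of G. Both divergences then reduce to
combinations of five covectors: ∇_l∇²R, R_{lk}∇^kR, R^{pq}∇_lR_{pq}, R^{mj}∇_mR_{jl} and
R_{jklm}∇^kR^{mj}. The coefficients agree: ½, 7/3, -3, 6, 4.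

If H = 0, then ∇^kΦ_{kl} = 0 follows at once. For a Killing field, what remains of the divergence of
the current is Φ_{kl}∇^kξ^l, a symmetric tensor paired with an antisymmetric one. If g is Einstein,
the contracted Bianchi identity makes R locally constant, and the algebraic terms of Φ are multiples
of R²g whose coefficients sum to zero. -/

lemma contDiffOn_pd (hU : IsOpen U) (hf : ContDiffOn ℝ ∞ f U) (i : Fin 4) :
    ContDiffOn ℝ ∞ (pd i f) U :=
  (hf.fderiv_of_isOpen hU (m := ∞) (by simp)).clm_apply contDiffOn_const

lemma differentiableAt_of_contDiffOn (hU : IsOpen U) (hf : ContDiffOn ℝ ∞ f U) (hx : x ∈ U) :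
    DifferentiableAt ℝ f x :=
  (hf.contDiffAt (hU.mem_nhds hx)).differentiableAt (by simp)

lemma pd_congr (hU : IsOpen U) (h : ∀ y ∈ U, f y = f' y) (hx : x ∈ U) (i : Fin 4) :
    pd i f x = pd i f' x := by
  have : f =ᶠ[nhds x] f' := Filter.eventually_of_mem (hU.mem_nhds hx) h
  simp only [pd, this.fderiv_eq]

lemma pd_add (hf : DifferentiableAt ℝ f x) (hf' : DifferentiableAt ℝ f' x) (i : Fin 4) :
    pd i (fun y => f y + f' y) x = pd i f x + pd i f' x := by
  simp [pd, fderiv_fun_add hf hf']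

lemma pd_sub (hf : DifferentiableAt ℝ f x) (hf' : DifferentiableAt ℝ f' x) (i : Fin 4) :
    pd i (fun y => f y - f' y) x = pd i f x - pd i f' x := by
  simp [pd, fderiv_fun_sub hf hf']

lemma pd_mul (hf : DifferentiableAt ℝ f x) (hf' : DifferentiableAt ℝ f' x) (i : Fin 4) :
    pd i (fun y => f y * f' y) x = pd i f x * f' x + f x * pd i f' x := by
  simp [pd, fderiv_fun_mul hf hf']; ring

lemma pd_const (c : ℝ) (i : Fin 4) : pd i (fun _ => c) x = 0 := by
  simp [pd]

lemma pd_sum {ι : Type*} (s : Finset ι) {F : ι → Coord → ℝ}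
    (hF : ∀ j ∈ s, DifferentiableAt ℝ (F j) x) (i : Fin 4) :
    pd i (fun y => ∑ j ∈ s, F j y) x = ∑ j ∈ s, pd i (F j) x := by
  simp [pd, fderiv_fun_sum hF]

lemma pd_comm (hU : IsOpen U) (hf : ContDiffOn ℝ ∞ f U) (hx : x ∈ U) (i j : Fin 4) :
    pd i (pd j f) x = pd j (pd i f) x := by
  have hs : IsSymmSndFDerivAt ℝ f x :=
    (hf.contDiffAt (hU.mem_nhds hx)).isSymmSndFDerivAt
      (by simpa using WithTop.coe_le_coe.2 (le_top : (2 : ℕ∞) ≤ ⊤))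
  have hd : DifferentiableAt ℝ (fderiv ℝ f) x :=
    ((hf.fderiv_of_isOpen hU (m := ∞) (by simp)).contDiffAt
      (hU.mem_nhds hx)).differentiableAt (by simp)
  have key (k l : Fin 4) : pd k (pd l f) x =
      fderiv ℝ (fderiv ℝ f) x (EuclideanSpace.single k 1) (EuclideanSpace.single l 1) := by
    have h : pd l f = fun y => fderiv ℝ f y (EuclideanSpace.single l 1) := rfl
    rw [pd, h, fderiv_clm_apply hd (differentiableAt_const _)]
    simp
  rw [key, key, hs.eq]

end PartialDerivatives

/-! ### Metrics on an open set of coordinate space -/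

/-- A smooth pseudo-Riemannian metric on the open subset `U` of `ℝ⁴`. -/
structure IsMetricOn (g : MetricField) (U : Set Coord) : Prop where
  isOpen : IsOpen U
  contDiffOn (i j : Fin 4) : ContDiffOn ℝ ∞ (fun x => g x i j) U
  symm {x : Coord} (hx : x ∈ U) (i j : Fin 4) : g x i j = g x j i
  det_ne_zero {x : Coord} (hx : x ∈ U) : (g x).det ≠ 0

/-- A tensor field with smooth components on `U`. -/
def SmoothOn {n : ℕ} (T : TensorField n) (U : Set Coord) : Prop :=
  ∀ a, ContDiffOn ℝ ∞ (T a) U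

/-- The metric as a tensor field. -/
def metric (g : MetricField) : TensorField 2 := fun a x => g x (a 0) (a 1)

/-- The contraction `g^{pq} T_{p q a₁ … aₙ}`. -/
def contr (g : MetricField) {n : ℕ} (T : TensorField (n + 2)) : TensorField n :=
  fun a x => ∑ p, ∑ q, (g x)⁻¹ p q * T (Fin.cons p (Fin.cons q a)) x

lemma divergence_eq_contr (g : MetricField) {n : ℕ} (T : TensorField (n + 1)) :
    divergence g T = contr g (covDeriv g T) := rfl

/-- The working form of `covDeriv`: with the derivative index split off, the corrections run over
the slots of `a` alone. -/
lemma covDeriv_cons (g : MetricField) {n : ℕ} (T : TensorField n) (i : Fin 4) (a : Fin n → Fin 4)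
    (x : Coord) : covDeriv g T (Fin.cons i a) x = pd i (T a) x -
      ∑ s : Fin n, ∑ m, christoffel g m i (a s) x * T (Function.update a s m) x := by
  simp [covDeriv]

lemma contDiffOn_det {n : ℕ} {A : Coord → Matrix (Fin n) (Fin n) ℝ} {U : Set Coord}
    (hA : ∀ i j, ContDiffOn ℝ ∞ (fun x => A x i j) U) :
    ContDiffOn ℝ ∞ (fun x => (A x).det) U := by
  simp only [Matrix.det_apply']
  exact ContDiffOn.sum fun σ _ => contDiffOn_const.mul (contDiffOn_prod fun i _ => hA _ _)

namespace IsMetricOn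

variable {g : MetricField} {U : Set Coord} (hg : IsMetricOn g U) {x : Coord}

include hg

/-- Cramer's rule: the entries of the inverse are polynomials in the entries of `g`, divided by a
nonvanishing determinant. -/
lemma contDiffOn_inv (i j : Fin 4) : ContDiffOn ℝ ∞ (fun x => (g x)⁻¹ i j) U := by
  have h1 : ContDiffOn ℝ ∞ (fun x => (g x).adjugate i j) U := by
    simp only [Matrix.adjugate_apply]
    refine contDiffOn_det fun k l => ?_
    by_cases hk : k = j
    · subst hk; simpa using contDiffOn_const
    · simpa [Matrix.updateRow_ne hk] using hg.contDiffOn k l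
  have h2 := (contDiffOn_det hg.contDiffOn).inv fun x hx => hg.det_ne_zero hx
  refine (h2.mul h1).congr fun x _ => ?_
  simp [Matrix.inv_def]

lemma isUnit_det (hx : x ∈ U) : IsUnit (g x).det := (hg.det_ne_zero hx).isUnit

lemma inv_symm (hx : x ∈ U) (i j : Fin 4) : (g x)⁻¹ i j = (g x)⁻¹ j i := by
  have h : (g x).transpose = g x := by ext i j; exact hg.symm hx j i
  have := Matrix.transpose_nonsing_inv (g x)
  rw [h] at this
  exact congr_fun₂ this j i

lemma inv_mul (hx : x ∈ U) (i j : Fin 4) :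
    ∑ k, (g x)⁻¹ i k * g x k j = if i = j then 1 else 0 := by
  have := congr_fun₂ (Matrix.nonsing_inv_mul (g x) (hg.isUnit_det hx)) i j
  rwa [Matrix.mul_apply, Matrix.one_apply] at this

lemma mul_inv (hx : x ∈ U) (i j : Fin 4) :
    ∑ k, g x i k * (g x)⁻¹ k j = if i = j then 1 else 0 := by
  have := congr_fun₂ (Matrix.mul_nonsing_inv (g x) (hg.isUnit_det hx)) i j
  rwa [Matrix.mul_apply, Matrix.one_apply] at this

lemma contDiffOn_christoffel (k i j : Fin 4) : ContDiffOn ℝ ∞ (christoffel g k i j) U := by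
  have := fun i j => hg.contDiffOn_inv i j
  have := fun k i j => contDiffOn_pd hg.isOpen (hg.contDiffOn i j) k
  unfold christoffel
  exact ContDiffOn.sum fun l _ => (contDiffOn_const.mul (hg.contDiffOn_inv _ _)).mul
    (((this _ _ _).add (this _ _ _)).sub (this _ _ _))

lemma christoffel_symm (hx : x ∈ U) (k i j : Fin 4) :
    christoffel g k i j x = christoffel g k j i x := by
  unfold christoffel
  refine Finset.sum_congr rfl fun l _ => ?_
  rw [pd_congr hg.isOpen (fun y hy => hg.symm hy i j) hx l]
  ring

lemma lower_christoffel (hx : x ∈ U) (l i j : Fin 4) :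
    ∑ m, g x l m * christoffel g m i j x = (1 / 2 : ℝ) * (pd i (fun y => g y j l) x +
      pd j (fun y => g y i l) x - pd l (fun y => g y i j) x) := by
  simp only [christoffel, Finset.mul_sum]
  rw [Finset.sum_comm]
  have h (n : Fin 4) (c : ℝ) :
      ∑ m, g x l m * ((1 / 2 : ℝ) * (g x)⁻¹ m n * c) = (if l = n then 1 else 0) * (1 / 2 * c) := by
    rw [← hg.mul_inv hx, Finset.sum_mul]
    exact Finset.sum_congr rfl fun m _ => by ring
  simp only [h]
  simp

/-- Metric compatibility in coordinates: in the sum of the two Christoffel symbols of the first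
kind, all derivatives of the metric cancel except ∂_i g_{jk}. -/
lemma pd_metric (hx : x ∈ U) (i j k : Fin 4) : pd i (fun y => g y j k) x =
    ∑ m, christoffel g m i j x * g x m k + ∑ m, christoffel g m i k x * g x j m := by
  have h1 := hg.lower_christoffel hx k i j
  have h2 := hg.lower_christoffel hx j i k
  rw [pd_congr hg.isOpen (fun y hy => hg.symm hy k j) hx i] at h2
  rw [pd_congr hg.isOpen (fun y hy => hg.symm hy i k) hx j,
    pd_congr hg.isOpen (fun y hy => hg.symm hy i j) hx k] at h1
  rw [pd_congr hg.isOpen (fun y hy => hg.symm hy i j) hx k,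
    pd_congr hg.isOpen (fun y hy => hg.symm hy i k) hx j] at h2
  have h3 : ∑ m, christoffel g m i j x * g x m k = ∑ m, g x k m * christoffel g m i j x :=
    Finset.sum_congr rfl fun m _ => by rw [hg.symm hx, mul_comm]
  have h4 : ∑ m, christoffel g m i k x * g x j m = ∑ m, g x j m * christoffel g m i k x :=
    Finset.sum_congr rfl fun m _ => by rw [mul_comm]
  rw [h3, h4, h1, h2]
  ring

lemma pd_inv (hx : x ∈ U) (i p q : Fin 4) : pd i (fun y => (g y)⁻¹ p q) x =
    -∑ m, christoffel g p i m x * (g x)⁻¹ m q - ∑ m, christoffel g q i m x * (g x)⁻¹ p m := by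
  set Γ : Matrix (Fin 4) (Fin 4) ℝ := Matrix.of fun a b => christoffel g a i b x
  set D : Matrix (Fin 4) (Fin 4) ℝ := Matrix.of fun a b => pd i (fun y => (g y)⁻¹ a b) x with hD
  have hdg (a b) := differentiableAt_of_contDiffOn hg.isOpen (hg.contDiffOn a b) hx
  have hdi (a b) := differentiableAt_of_contDiffOn hg.isOpen (hg.contDiffOn_inv a b) hx
  -- The derivative of g⁻¹g = 1, with ∂_i g = Γᵀg + gΓ inserted; multiplying by g⁻¹ on the right
  -- then solves for D.
  have h1 : D * g x + (g x)⁻¹ * (Γ.transpose * g x + g x * Γ) = 0 := by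
    ext a b
    have h := pd_congr hg.isOpen (fun y hy => hg.inv_mul hy a b) hx i
    rw [pd_const, pd_sum _ fun k _ => (hdi a k).fun_mul (hdg k b)] at h
    simp only [pd_mul (hdi _ _) (hdg _ _), Finset.sum_add_distrib] at h
    simp only [Matrix.add_apply, Matrix.mul_apply, Matrix.zero_apply, Matrix.transpose_apply,
      Matrix.of_apply, D, Γ]
    rw [← h]
    congr 1
    refine Finset.sum_congr rfl fun k _ => ?_
    rw [hg.pd_metric hx]
    simp only [mul_comm (christoffel _ _ i b _)]
  have hu := hg.isUnit_det hx
  have h2 : D = -(Γ * (g x)⁻¹) - (g x)⁻¹ * Γ.transpose := by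
    have h3 : D * g x * (g x)⁻¹ = -((g x)⁻¹ * (Γ.transpose * g x + g x * Γ)) * (g x)⁻¹ := by
      rw [eq_neg_of_add_eq_zero_left h1]
    rw [Matrix.mul_nonsing_inv_cancel_right _ _ hu] at h3
    rw [h3]
    have e1 := Matrix.mul_nonsing_inv (g x) hu
    have e2 := Matrix.nonsing_inv_mul (g x) hu
    simp only [mul_add, add_mul, neg_mul, mul_assoc, e1, mul_one, neg_add]
    rw [← mul_assoc (g x)⁻¹ (g x), e2, one_mul]
    abel
  have := congr_fun₂ h2 p q
  simp only [hD, Matrix.of_apply, Matrix.sub_apply, Matrix.neg_apply, Matrix.mul_apply,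
    Matrix.transpose_apply, Γ] at this
  rw [this]
  simp only [mul_comm]

end IsMetricOn

/-! ### The calculus of covariant derivatives -/

section TensorCalculus

variable {g : MetricField} {U : Set Coord} {x : Coord} {n m : ℕ}

lemma covDeriv_congr (hU : IsOpen U) {T S : TensorField n} (h : ∀ a, ∀ y ∈ U, T a y = S a y)
    (hx : x ∈ U) (a : Fin (n + 1) → Fin 4) : covDeriv g T a x = covDeriv g S a x := by
  simp only [covDeriv, pd_congr hU (h _) hx, h _ x hx]

lemma SmoothOn.differentiableAt {T : TensorField n} (hT : SmoothOn T U) (hU : IsOpen U)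
    (hx : x ∈ U) (a : Fin n → Fin 4) : DifferentiableAt ℝ (T a) x :=
  differentiableAt_of_contDiffOn hU (hT a) hx

lemma covDeriv_add (hU : IsOpen U) {T S : TensorField n} (hT : SmoothOn T U) (hS : SmoothOn S U)
    (hx : x ∈ U) (a : Fin (n + 1) → Fin 4) :
    covDeriv g (fun a x => T a x + S a x) a x = covDeriv g T a x + covDeriv g S a x := by
  simp only [covDeriv, pd_add (hT.differentiableAt hU hx _) (hS.differentiableAt hU hx _),
    mul_add, Finset.sum_add_distrib]
  ring

lemma covDeriv_const_mul (hU : IsOpen U) {T : TensorField n} (hT : SmoothOn T U) (c : ℝ)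
    (hx : x ∈ U) (a : Fin (n + 1) → Fin 4) :
    covDeriv g (fun a x => c * T a x) a x = c * covDeriv g T a x := by
  simp only [covDeriv, pd_mul (differentiableAt_const c) (hT.differentiableAt hU hx _), pd_const,
    mul_sub, Finset.mul_sum]
  simp only [zero_mul, zero_add, mul_left_comm c]

/-- The combinatorics of the Leibniz rule. Bijectivity of `Sum.elim σ τ` says that each of the N
slots belongs to exactly one factor, so altering a slot affects that factor only. -/
lemma sum_update_comp {N : ℕ} (σ : Fin n → Fin N) (τ : Fin m → Fin N)
    (h : Function.Bijective (Sum.elim σ τ)) (a : Fin N → Fin 4) (F : Fin 4 → Fin 4 → ℝ)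
    (A : (Fin n → Fin 4) → ℝ) (B : (Fin m → Fin 4) → ℝ) :
    ∑ s, ∑ k, F k (a s) * (A (Function.update a s k ∘ σ) * B (Function.update a s k ∘ τ)) =
      (∑ s, ∑ k, F k (a (σ s)) * A (Function.update (a ∘ σ) s k)) * B (a ∘ τ) +
      A (a ∘ σ) * ∑ s, ∑ k, F k (a (τ s)) * B (Function.update (a ∘ τ) s k) := by
  have hσ : Function.Injective σ := h.injective.comp Sum.inl_injective
  have hτ : Function.Injective τ := h.injective.comp Sum.inr_injective
  have hne (i : Fin n) (j : Fin m) : σ i ≠ τ j := fun e =>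
    Sum.inl_ne_inr (h.injective (show Sum.elim σ τ (.inl i) = Sum.elim σ τ (.inr j) from e))
  rw [← h.sum_comp, Fintype.sum_sum_type]
  simp only [Sum.elim_inl, Sum.elim_inr, Function.update_comp_eq_of_injective _ hσ,
    Function.update_comp_eq_of_injective _ hτ,
    Function.update_comp_eq_of_forall_ne _ _ (fun j => hne j _),
    Function.update_comp_eq_of_forall_ne _ _ (fun j => (hne _ j).symm)]
  simp only [Finset.sum_mul, Finset.mul_sum]
  congr 1 <;> exact Finset.sum_congr rfl fun s _ => Finset.sum_congr rfl fun k _ => by ring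

/-- The product rule, for a product of two tensors whose indices are shuffled. -/
lemma covDeriv_mul (hU : IsOpen U) {T : TensorField n} {S : TensorField m} (hT : SmoothOn T U)
    (hS : SmoothOn S U) (hx : x ∈ U) {N : ℕ} (σ : Fin n → Fin N) (τ : Fin m → Fin N)
    (h : Function.Bijective (Sum.elim σ τ)) (i : Fin 4) (a : Fin N → Fin 4) :
    covDeriv g (fun a x => T (a ∘ σ) x * S (a ∘ τ) x) (Fin.cons i a) x =
      covDeriv g T (Fin.cons i (a ∘ σ)) x * S (a ∘ τ) x +
        T (a ∘ σ) x * covDeriv g S (Fin.cons i (a ∘ τ)) x := by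
  simp only [covDeriv_cons, pd_mul (hT.differentiableAt hU hx _) (hS.differentiableAt hU hx _)]
  rw [sum_update_comp σ τ h a (fun k b => christoffel g k i b x) (fun a => T a x) (fun a => S a x)]
  simp only [Function.comp_apply]
  ring

/-- Covariant differentiation commutes with permutations of the indices. -/
lemma covDeriv_perm (T : TensorField n) (σ : Fin n → Fin n)
    (h : Function.Bijective σ) (i : Fin 4) (a : Fin n → Fin 4) :
    covDeriv g (fun a x => T (a ∘ σ) x) (Fin.cons i a) x =
      covDeriv g T (Fin.cons i (a ∘ σ)) x := by
  simp only [covDeriv_cons]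
  rw [← h.sum_comp]
  simp only [Function.update_comp_eq_of_injective _ h.injective, Function.comp_apply]

namespace IsMetricOn

variable (hg : IsMetricOn g U)
include hg

lemma smoothOn_covDeriv {T : TensorField n} (hT : SmoothOn T U) : SmoothOn (covDeriv g T) U := by
  intro a
  refine (contDiffOn_pd hg.isOpen (hT _) _).sub (ContDiffOn.sum fun s _ => ContDiffOn.sum
    fun m _ => (hg.contDiffOn_christoffel _ _ _).mul (hT _))

lemma smoothOn_contr {T : TensorField (n + 2)} (hT : SmoothOn T U) : SmoothOn (contr g T) U :=
  fun _ => ContDiffOn.sum fun _ _ => ContDiffOn.sum fun _ _ => (hg.contDiffOn_inv _ _).mul (hT _)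

lemma covDeriv_metric (hx : x ∈ U) (a : Fin 3 → Fin 4) : covDeriv g (metric g) a x = 0 := by
  rw [← Fin.cons_self_tail a, covDeriv_cons]
  generalize a 0 = i
  generalize Fin.tail a = b
  have : pd i (metric g b) x = pd i (fun y => g y (b 0) (b 1)) x := rfl
  rw [this, hg.pd_metric hx]
  simp [Fin.sum_univ_two, metric]

/-- Covariant differentiation commutes with contraction. -/
lemma covDeriv_contr {T : TensorField (n + 2)} (hT : SmoothOn T U) (hx : x ∈ U) (i : Fin 4)
    (a : Fin n → Fin 4) : covDeriv g (contr g T) (Fin.cons i a) x =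
      ∑ p, ∑ q, (g x)⁻¹ p q * covDeriv g T (Fin.cons i (Fin.cons p (Fin.cons q a))) x := by
  have hdi (p q) := differentiableAt_of_contDiffOn hg.isOpen (hg.contDiffOn_inv p q) hx
  have hdT := hT.differentiableAt hg.isOpen hx
  have hpd : pd i (contr g T a) x = ∑ p, ∑ q,
      (pd i (fun y => (g y)⁻¹ p q) x * T (Fin.cons p (Fin.cons q a)) x +
        (g x)⁻¹ p q * pd i (T (Fin.cons p (Fin.cons q a))) x) := by
    unfold contr
    rw [pd_sum _ fun p _ => DifferentiableAt.fun_sum fun q _ => (hdi p q).fun_mul (hdT _)]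
    refine Finset.sum_congr rfl fun p _ => ?_
    rw [pd_sum _ fun q _ => (hdi p q).fun_mul (hdT _)]
    exact Finset.sum_congr rfl fun q _ => pd_mul (hdi _ _) (hdT _) _
  rw [covDeriv_cons, hpd]
  simp only [covDeriv_cons]
  simp only [Fin.sum_univ_succ (n := n + 1), Fin.sum_univ_succ (n := n), Fin.cons_zero,
    Fin.cons_succ, Fin.update_cons_zero, ← Fin.cons_update, hg.pd_inv hx]
  -- By `pd_inv`, the two terms of ∂_i g^{pq} are, after renaming dummy indices, exactly the
  -- Christoffel corrections in the two contracted slots (`e1`, `e2`); `e3` treats the free slots.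
  have e1 : ∑ p, ∑ q, (∑ m, christoffel g p i m x * (g x)⁻¹ m q) *
      T (Fin.cons p (Fin.cons q a)) x = ∑ p, ∑ q, (g x)⁻¹ p q *
        ∑ m, christoffel g m i p x * T (Fin.cons m (Fin.cons q a)) x := by
    simp only [Finset.sum_mul, Finset.mul_sum]
    -- The nested sums become one sum over a product, reindexed by a permutation of the dummy
    -- indices. The same device recurs below.
    simp only [← Fintype.sum_prod_type']
    refine Fintype.sum_equiv (Equiv.mk (fun z : Fin 4 × Fin 4 × Fin 4 => (z.2.2, z.2.1, z.1))
      (fun z => (z.2.2, z.2.1, z.1)) (fun _ => rfl) (fun _ => rfl)) _ _ fun z => ?_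
    simp only [Equiv.coe_fn_mk]
    ring
  have e2 : ∑ p, ∑ q, (∑ m, christoffel g q i m x * (g x)⁻¹ p m) *
      T (Fin.cons p (Fin.cons q a)) x = ∑ p, ∑ q, (g x)⁻¹ p q *
        ∑ m, christoffel g m i q x * T (Fin.cons p (Fin.cons m a)) x := by
    simp only [Finset.sum_mul, Finset.mul_sum]
    refine Finset.sum_congr rfl fun p _ => ?_
    rw [Finset.sum_comm]
    exact Finset.sum_congr rfl fun _ _ => Finset.sum_congr rfl fun _ _ => by ring
  have e3 : ∑ s, ∑ m, christoffel g m i (a s) x * contr g T (Function.update a s m) x =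
      ∑ p, ∑ q, (g x)⁻¹ p q * ∑ s, ∑ m, christoffel g m i (a s) x *
        T (Fin.cons p (Fin.cons q (Function.update a s m))) x := by
    simp only [contr, Finset.mul_sum]
    simp only [← Fintype.sum_prod_type']
    refine Fintype.sum_equiv (Equiv.mk (fun z : Fin n × Fin 4 × Fin 4 × Fin 4 =>
      (z.2.2.1, z.2.2.2, z.1, z.2.1)) (fun z => (z.2.2.1, z.2.2.2, z.1, z.2.1))
      (fun _ => rfl) (fun _ => rfl)) _ _ fun z => ?_
    simp only [Equiv.coe_fn_mk]
    ring
  rw [e3]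
  simp only [sub_mul, neg_mul, mul_add, mul_sub, Finset.sum_add_distrib,
    Finset.sum_sub_distrib, Finset.sum_neg_distrib, e1, e2]
  ring

end IsMetricOn

/-- The algebra behind the Ricci identity. F and G play the role of the connection matrices Γ_i and
Γ_j acting slot by slot. Actions on distinct slots commute and drop out of the difference; two
actions on the same slot leave the matrix commutator. -/
lemma sum_update_update_sub (F G : Fin 4 → Fin 4 → ℝ) (A : (Fin n → Fin 4) → ℝ)
    (a : Fin n → Fin 4) :
    ∑ s, ∑ m, F m (a s) * ∑ t, ∑ k, G k (Function.update a s m t) *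
        A (Function.update (Function.update a s m) t k) -
      ∑ s, ∑ m, G m (a s) * ∑ t, ∑ k, F k (Function.update a s m t) *
        A (Function.update (Function.update a s m) t k) =
      -∑ s, ∑ m, (∑ e, (F m e * G e (a s) - G m e * F e (a s))) * A (Function.update a s m) := by
  have split (F G : Fin 4 → Fin 4 → ℝ) :
      ∑ s, ∑ m, F m (a s) * ∑ t, ∑ k, G k (Function.update a s m t) *
        A (Function.update (Function.update a s m) t k) =
      ∑ s, ∑ m, (∑ e, G m e * F e (a s)) * A (Function.update a s m) +
      ∑ s, ∑ t, ∑ m, ∑ k, if t = s then 0 else F m (a s) * G k (a t) *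
        A (Function.update (Function.update a s m) t k) := by
    rw [← Finset.sum_add_distrib]
    refine Finset.sum_congr rfl fun s _ => ?_
    have h (m : Fin 4) : ∑ t, ∑ k, G k (Function.update a s m t) *
        A (Function.update (Function.update a s m) t k) =
        ∑ k, G k m * A (Function.update a s k) + ∑ t, ∑ k, if t = s then 0 else
          G k (a t) * A (Function.update (Function.update a s m) t k) := by
      rw [← Finset.add_sum_erase _ _ (Finset.mem_univ s),
        ← Finset.add_sum_erase (f := fun t => ∑ k, if t = s then 0 else
          G k (a t) * A (Function.update (Function.update a s m) t k)) _ (Finset.mem_univ s)]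
      simp only [Function.update_self, Function.update_idem, if_true, Finset.sum_const_zero,
        zero_add]
      congr 1
      refine Finset.sum_congr rfl fun t ht => Finset.sum_congr rfl fun k _ => ?_
      have := Finset.ne_of_mem_erase ht
      rw [if_neg this, Function.update_of_ne this]
    simp only [h, mul_add, Finset.sum_add_distrib]
    congr 1
    · simp only [Finset.mul_sum, Finset.sum_mul]
      rw [Finset.sum_comm]
      exact Finset.sum_congr rfl fun _ _ => Finset.sum_congr rfl fun _ _ => by ring
    · simp only [Finset.mul_sum]
      rw [Finset.sum_comm]
      exact Finset.sum_congr rfl fun _ _ => Finset.sum_congr rfl fun _ _ =>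
        Finset.sum_congr rfl fun _ _ => by split_ifs <;> ring
  have swap : ∑ s, ∑ t, ∑ m, ∑ k, (if t = s then 0 else F m (a s) * G k (a t) *
        A (Function.update (Function.update a s m) t k)) =
      ∑ s, ∑ t, ∑ m, ∑ k, if t = s then 0 else G m (a s) * F k (a t) *
        A (Function.update (Function.update a s m) t k) := by
    rw [Finset.sum_comm]
    refine Finset.sum_congr rfl fun t _ => Finset.sum_congr rfl fun s _ => ?_
    rw [Finset.sum_comm]
    refine Finset.sum_congr rfl fun k _ => Finset.sum_congr rfl fun m _ => ?_
    by_cases h : t = s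
    · simp [h]
    · rw [if_neg h, if_neg (Ne.symm h), Function.update_comm h]
      ring
  rw [split F G, split G F, swap]
  simp only [Finset.sum_sub_distrib, sub_mul]
  ring

/-- The Ricci identity. -/
lemma IsMetricOn.ricci_identity (hg : IsMetricOn g U) {T : TensorField n} (hT : SmoothOn T U)
    (hx : x ∈ U) (i j : Fin 4) (a : Fin n → Fin 4) :
    covDeriv g (covDeriv g T) (Fin.cons i (Fin.cons j a)) x -
      covDeriv g (covDeriv g T) (Fin.cons j (Fin.cons i a)) x =
      -∑ s, ∑ m, riemannUp g m (a s) i j x * T (Function.update a s m) x := by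
  have hdT := hT.differentiableAt hg.isOpen hx
  have hdΓ (a b c) := differentiableAt_of_contDiffOn hg.isOpen (hg.contDiffOn_christoffel a b c) hx
  have hpd (i j : Fin 4) : pd i (covDeriv g T (Fin.cons j a)) x = pd i (pd j (T a)) x -
      ∑ s, ∑ m, (pd i (christoffel g m j (a s)) x * T (Function.update a s m) x +
        christoffel g m j (a s) x * pd i (T (Function.update a s m)) x) := by
    have : covDeriv g T (Fin.cons j a) = fun y => pd j (T a) y -
        ∑ s, ∑ m, christoffel g m j (a s) y * T (Function.update a s m) y :=
      funext fun y => covDeriv_cons g T j a y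
    rw [this, pd_sub (differentiableAt_of_contDiffOn hg.isOpen
        (contDiffOn_pd hg.isOpen (hT a) j) hx)
      (DifferentiableAt.fun_sum fun s _ => DifferentiableAt.fun_sum fun m _ =>
        (hdΓ _ _ _).fun_mul (hdT _)),
      pd_sum _ fun s _ => DifferentiableAt.fun_sum fun m _ => (hdΓ _ _ _).fun_mul (hdT _)]
    congr 1
    refine Finset.sum_congr rfl fun s _ => ?_
    rw [pd_sum _ fun m _ => (hdΓ _ _ _).fun_mul (hdT _)]
    exact Finset.sum_congr rfl fun m _ => pd_mul (hdΓ _ _ _) (hdT _) _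
  have key := sum_update_update_sub (fun m b => christoffel g m i b x)
    (fun m b => christoffel g m j b x) (fun a => T a x) a
  -- Second partials cancel by symmetry, and the correction in the derivative slot cancels because
  -- the connection is torsion free. The terms Γ∂T cancel in the difference; `key` handles those
  -- quadratic in Γ.
  rw [covDeriv_cons, covDeriv_cons _ _ j, hpd, hpd, pd_comm hg.isOpen (hT a) hx i j]
  simp only [Fin.sum_univ_succ (n := n), Fin.cons_zero, Fin.cons_succ, Fin.update_cons_zero,
    ← Fin.cons_update, riemannUp, hg.christoffel_symm hx _ j i]
  simp only [covDeriv_cons, mul_sub, add_mul, sub_mul, Finset.sum_add_distrib,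
    Finset.sum_sub_distrib] at key ⊢
  linarith

end TensorCalculus

/-! ### Curvature identities -/

/-- The Riemann tensor as a tensor field. -/
def riemannTensor (g : MetricField) : TensorField 4 :=
  fun a x => riemann g (a 0) (a 1) (a 2) (a 3) x

/-- A function as a tensor field of rank zero. -/
def scalarField (f : Coord → ℝ) : TensorField 0 := fun _ => f

lemma covDeriv_scalarField (g : MetricField) (f : Coord → ℝ) :
    covDeriv g (scalarField f) = grad f := by
  funext a x
  simp [covDeriv, scalarField, grad]

lemma contr_ricci (g : MetricField) : contr g (ricci g) = scalarField (scalarCurv g) := rfl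

lemma riemannUp_swap (g : MetricField) (a b c d : Fin 4) (x : Coord) :
    riemannUp g a b c d x = -riemannUp g a b d c x := by
  simp only [riemannUp, Finset.sum_sub_distrib]
  ring

lemma riemann_swap_right (g : MetricField) (a b c d : Fin 4) (x : Coord) :
    riemann g a b c d x = -riemann g a b d c x := by
  simp only [riemann, riemannUp_swap g _ b c d, mul_neg, Finset.sum_neg_distrib]

namespace IsMetricOn

variable {g : MetricField} {U : Set Coord} (hg : IsMetricOn g U) {x : Coord}
include hg

lemma smoothOn_metric : SmoothOn (metric g) U := fun _ => hg.contDiffOn _ _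

lemma contDiffOn_riemannUp (a b c d : Fin 4) : ContDiffOn ℝ ∞ (riemannUp g a b c d) U := by
  have h := hg.contDiffOn_christoffel
  exact ((contDiffOn_pd hg.isOpen (h _ _ _) _).sub (contDiffOn_pd hg.isOpen (h _ _ _) _)).add
    (ContDiffOn.sum fun e _ => ((h _ _ _).mul (h _ _ _)).sub ((h _ _ _).mul (h _ _ _)))

lemma smoothOn_riemannTensor : SmoothOn (riemannTensor g) U := fun a =>
  ContDiffOn.sum (s := Finset.univ)
    (f := fun e x => g x (a 0) e * riemannUp g e (a 1) (a 2) (a 3) x)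
    fun _ _ => (hg.contDiffOn _ _).mul (hg.contDiffOn_riemannUp _ _ _ _)

lemma smoothOn_ricci : SmoothOn (ricci g) U := fun _ =>
  ContDiffOn.sum fun _ _ => hg.contDiffOn_riemannUp _ _ _ _

lemma contDiffOn_scalarCurv : ContDiffOn ℝ ∞ (scalarCurv g) U :=
  hg.smoothOn_contr hg.smoothOn_ricci ![]

lemma inv_mul_metric_mul (hx : x ∈ U) (i : Fin 4) (v : Fin 4 → ℝ) :
    ∑ k, (g x)⁻¹ i k * ∑ j, g x k j * v j = v i := by
  simp only [Finset.mul_sum, ← mul_assoc]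
  rw [Finset.sum_comm]
  simp only [← Finset.sum_mul, hg.inv_mul hx]
  simp

lemma riemannUp_eq (hx : x ∈ U) (a b c d : Fin 4) :
    riemannUp g a b c d x = ∑ e, (g x)⁻¹ a e * riemann g e b c d x :=
  (hg.inv_mul_metric_mul hx a fun e => riemannUp g e b c d x).symm

/-- The Ricci identity applied to the metric: the left side vanishes since ∇g = 0, and the right
side is -(R_{abcd} + R_{bacd}) up to the order of the two terms. -/
lemma riemann_swap_left (hx : x ∈ U) (a b c d : Fin 4) :
    riemann g a b c d x = -riemann g b a c d x := by
  have h0 (i j) : covDeriv g (covDeriv g (metric g)) (Fin.cons i (Fin.cons j ![a, b])) x = 0 := by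
    rw [covDeriv_congr hg.isOpen (S := fun _ _ => 0) (fun a y hy => hg.covDeriv_metric hy a) hx]
    simp [covDeriv, pd_const]
  have h := hg.ricci_identity hg.smoothOn_metric hx c d ![a, b]
  rw [h0, h0, Fin.sum_univ_two] at h
  simp only [metric, Matrix.cons_val_zero, Matrix.cons_val_one, Function.update_self, ne_eq,
    zero_ne_one, one_ne_zero, not_false_eq_true, Function.update_of_ne] at h
  simp only [riemann]
  have e1 : ∑ e, g x a e * riemannUp g e b c d x = ∑ e, riemannUp g e b c d x * g x a e :=
    Finset.sum_congr rfl fun _ _ => mul_comm _ _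
  have e2 : ∑ e, g x b e * riemannUp g e a c d x = ∑ e, riemannUp g e a c d x * g x e b :=
    Finset.sum_congr rfl fun _ _ => by rw [hg.symm hx, mul_comm]
  rw [e1, e2]
  linarith

lemma pd_christoffel_symm (hx : x ∈ U) (l k i j : Fin 4) :
    pd l (christoffel g k i j) x = pd l (christoffel g k j i) x :=
  pd_congr hg.isOpen (fun _ hy => hg.christoffel_symm hy k i j) hx l

/-- The first Bianchi identity. -/
lemma riemann_cyclic (hx : x ∈ U) (a b c d : Fin 4) :
    riemann g a b c d x + riemann g a c d b x + riemann g a d b c x = 0 := by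
  simp only [riemann, ← Finset.sum_add_distrib]
  refine Finset.sum_eq_zero fun e _ => ?_
  rw [← mul_add, ← mul_add]
  simp only [riemannUp, Finset.sum_sub_distrib]
  rw [hg.pd_christoffel_symm hx c e d b, hg.pd_christoffel_symm hx d e c b,
    hg.pd_christoffel_symm hx b e d c]
  simp only [hg.christoffel_symm hx _ d b, hg.christoffel_symm hx _ c b,
    hg.christoffel_symm hx _ d c]
  ring

/-- The classical octahedron argument: four instances of the first Bianchi identity combine linearly
with the two antisymmetries. -/
lemma riemann_pair (hx : x ∈ U) (a b c d : Fin 4) :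
    riemann g a b c d x = riemann g c d a b x := by
  have h1 := hg.riemann_cyclic hx a b c d
  have h2 := hg.riemann_cyclic hx b c d a
  have h3 := hg.riemann_cyclic hx c d a b
  have h4 := hg.riemann_cyclic hx d a b c
  have s := riemann_swap_right g (x := x)
  have t := hg.riemann_swap_left hx
  linarith [s a b c d, s a c d b, s a d b c, s b c d a, s b d a c, s b a c d, s c d a b, s c a b d,
    s c b d a, s d a b c, s d b c a, s d c a b, t a b c d, t a c d b, t a d b c, t b c d a,
    t b d a c, t b a c d, t c d a b, t c a b d, t c b d a, t d a b c, t d b c a, t d c a b]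

/-- Because ∇g = 0, lowering the first index commutes with ∇. The bracket is the derivative of the
curvature regarded as a matrix in its first two indices; the corrections for c and d are kept apart,
since they cancel separately in the cyclic sum. -/
lemma covDeriv_riemannTensor (hx : x ∈ U) (e a b c d : Fin 4) :
    covDeriv g (riemannTensor g) ![e, a, b, c, d] x =
      ∑ f, g x a f * (pd e (riemannUp g f b c d) x +
        ∑ m, christoffel g f e m x * riemannUp g m b c d x -
        ∑ m, riemannUp g f m c d x * christoffel g m e b x) -
      ∑ m, christoffel g m e c x * riemann g a b m d x -
      ∑ m, christoffel g m e d x * riemann g a b c m x := by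
  have hpd : pd e (riemannTensor g ![a, b, c, d]) x = ∑ f,
      (pd e (fun y => g y a f) x * riemannUp g f b c d x +
        g x a f * pd e (riemannUp g f b c d) x) := by
    have hdg (f) := differentiableAt_of_contDiffOn hg.isOpen (hg.contDiffOn a f) hx
    have hdr (f) :=
      differentiableAt_of_contDiffOn hg.isOpen (hg.contDiffOn_riemannUp f b c d) hx
    have : riemannTensor g ![a, b, c, d] = fun y => ∑ f, g y a f * riemannUp g f b c d y := rfl
    rw [this, pd_sum _ fun f _ => (hdg f).fun_mul (hdr f)]
    exact Finset.sum_congr rfl fun f _ => pd_mul (hdg f) (hdr f) e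
  have h := covDeriv_cons g (riemannTensor g) e ![a, b, c, d] x
  rw [hpd] at h
  refine (show _ = _ from h).trans ?_
  rw [Fin.sum_univ_four (fun s => ∑ m, christoffel g m e (![a, b, c, d] s) x *
    riemannTensor g (Function.update ![a, b, c, d] s m) x)]
  have e1 : ∑ f, (∑ m, christoffel g m e a x * g x m f) * riemannUp g f b c d x =
      ∑ m, christoffel g m e a x * riemann g m b c d x := by
    simp only [riemann, Finset.mul_sum, Finset.sum_mul]
    rw [Finset.sum_comm]
    simp only [mul_assoc]
  have e2 : ∑ f, (∑ m, christoffel g m e f x * g x a m) * riemannUp g f b c d x =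
      ∑ f, g x a f * ∑ m, christoffel g f e m x * riemannUp g m b c d x := by
    simp only [Finset.mul_sum, Finset.sum_mul]
    rw [Finset.sum_comm]
    exact Finset.sum_congr rfl fun _ _ => Finset.sum_congr rfl fun _ _ => by ring
  have e3 : ∑ m, christoffel g m e b x * riemann g a m c d x =
      ∑ f, g x a f * ∑ m, riemannUp g f m c d x * christoffel g m e b x := by
    simp only [riemann, Finset.mul_sum]
    rw [Finset.sum_comm]
    exact Finset.sum_congr rfl fun _ _ => Finset.sum_congr rfl fun _ _ => by ring
  simp only [riemannTensor, hg.pd_metric hx, add_mul, mul_add, mul_sub, Finset.sum_add_distrib,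
    Finset.sum_sub_distrib, e1, e2, ← e3]
  simp
  ring

/-- The second Bianchi identity. -/
lemma covDeriv_riemann_cyclic (hx : x ∈ U) (e a b c d : Fin 4) :
    covDeriv g (riemannTensor g) ![e, a, b, c, d] x +
      covDeriv g (riemannTensor g) ![c, a, b, d, e] x +
      covDeriv g (riemannTensor g) ![d, a, b, e, c] x = 0 := by
  -- Matrix form of the curvature: F_{cd} = ∂_cΓ_d - ∂_dΓ_c + [Γ_c, Γ_d], and V e c d is ∂_eF_{cd} +
  -- [Γ_e, F_{cd}] with the derivatives expanded.
  set Γ : Fin 4 → Matrix (Fin 4) (Fin 4) ℝ := fun c => Matrix.of fun a b => christoffel g a c b x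
  set P : Fin 4 → Fin 4 → Matrix (Fin 4) (Fin 4) ℝ :=
    fun e c => Matrix.of fun a b => pd e (christoffel g a c b) x
  set Q : Fin 4 → Fin 4 → Fin 4 → Matrix (Fin 4) (Fin 4) ℝ :=
    fun e c d => Matrix.of fun a b => pd e (pd c (christoffel g a d b)) x
  set V : Fin 4 → Fin 4 → Fin 4 → Matrix (Fin 4) (Fin 4) ℝ := fun e c d =>
    Q e c d - Q e d c + (P e c * Γ d + Γ c * P e d) - (P e d * Γ c + Γ d * P e c) +
      Γ e * (P c d - P d c + (Γ c * Γ d - Γ d * Γ c)) -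
      (P c d - P d c + (Γ c * Γ d - Γ d * Γ c)) * Γ e with hV
  have hQ (e c d) : Q e c d = Q c e d := by
    ext a b
    exact pd_comm hg.isOpen (hg.contDiffOn_christoffel _ _ _) hx _ _
  -- The Bianchi identity for a matrix connection: once second partials are put in a common order,
  -- the cyclic sum vanishes by noncommutative ring algebra.
  have hcyc : V e c d + V c d e + V d e c = 0 := by
    simp only [hV, hQ e c d, hQ d e c, hQ d c e]
    noncomm_ring
  have hF (a b c d) : riemannUp g a b c d x = (P c d - P d c + (Γ c * Γ d - Γ d * Γ c)) a b := by
    simp [riemannUp, P, Γ, Matrix.mul_apply]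
  have hpd (e a b c d) : pd e (riemannUp g a b c d) x =
      (Q e c d - Q e d c + (P e c * Γ d + Γ c * P e d) - (P e d * Γ c + Γ d * P e c)) a b := by
    have h1 (i j k) :=
      differentiableAt_of_contDiffOn hg.isOpen (hg.contDiffOn_christoffel i j k) hx
    have h2 (l i j k) := differentiableAt_of_contDiffOn hg.isOpen
      (contDiffOn_pd hg.isOpen (hg.contDiffOn_christoffel i j k) l) hx
    have : riemannUp g a b c d = fun y => (pd c (christoffel g a d b) y -
      pd d (christoffel g a c b) y) + ∑ e, (christoffel g a c e y * christoffel g e d b y -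
      christoffel g a d e y * christoffel g e c b y) := rfl
    rw [this, pd_add ((h2 _ _ _ _).fun_sub (h2 _ _ _ _)) (DifferentiableAt.fun_sum fun _ _ =>
      ((h1 _ _ _).fun_mul (h1 _ _ _)).fun_sub ((h1 _ _ _).fun_mul (h1 _ _ _))),
      pd_sub (h2 _ _ _ _) (h2 _ _ _ _), pd_sum _ fun _ _ =>
      ((h1 _ _ _).fun_mul (h1 _ _ _)).fun_sub ((h1 _ _ _).fun_mul (h1 _ _ _))]
    simp only [pd_sub ((h1 _ _ _).fun_mul (h1 _ _ _)) ((h1 _ _ _).fun_mul (h1 _ _ _)),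
      pd_mul (h1 _ _ _) (h1 _ _ _), Finset.sum_sub_distrib, Finset.sum_add_distrib, P, Q, Γ,
      Matrix.add_apply, Matrix.sub_apply, Matrix.mul_apply, Matrix.of_apply]
    ring
  have hVab (e f b c d) : pd e (riemannUp g f b c d) x +
        ∑ m, christoffel g f e m x * riemannUp g m b c d x -
        ∑ m, riemannUp g f m c d x * christoffel g m e b x = V e c d f b := by
    rw [hpd]
    simp only [hF]
    rfl
  simp only [hg.covDeriv_riemannTensor hx, hVab]
  have hsum : ∑ f, g x a f * V e c d f b + ∑ f, g x a f * V c d e f b +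
      ∑ f, g x a f * V d e c f b = 0 := by
    simp only [← Finset.sum_add_distrib, ← mul_add]
    refine Finset.sum_eq_zero fun f _ => ?_
    have := congr_fun₂ hcyc f b
    simp only [Matrix.add_apply, Matrix.zero_apply] at this
    rw [this, mul_zero]
  -- Torsion freeness and antisymmetry in the last pair make the six corrections for the last two
  -- slots cancel in pairs.
  have hsw (p q r : Fin 4) : ∑ m, christoffel g m p q x * riemann g a b m r x =
      -∑ m, christoffel g m q p x * riemann g a b r m x := by
    rw [← Finset.sum_neg_distrib]
    exact Finset.sum_congr rfl fun m _ => by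
      rw [hg.christoffel_symm hx, riemann_swap_right g a b m r, mul_neg]
  rw [hsw e c d, hsw c d e, hsw d e c]
  linarith

end IsMetricOn

/-! ### Contracted identities -/

lemma fin_cons_eq_vecCons {n : ℕ} (i : Fin 4) (a : Fin n → Fin 4) :
    (Fin.cons i a : Fin (n + 1) → Fin 4) = Matrix.vecCons i a := rfl

lemma comp_vecCons' {n m : ℕ} (a : Fin m → Fin 4) (i : Fin m) (u : Fin n → Fin m) :
    a ∘ Matrix.vecCons i u = Matrix.vecCons (a i) (a ∘ u) := by
  funext j
  refine Fin.cases ?_ (fun k => ?_) j <;> rfl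

lemma comp_vecEmpty' {m : ℕ} (a : Fin m → Fin 4) (u : Fin 0 → Fin m) : a ∘ u = ![] :=
  Subsingleton.elim _ _

lemma contr_vecCons (g : MetricField) {n : ℕ} (T : TensorField (n + 2)) (a : Fin n → Fin 4)
    (x : Coord) : contr g T a x =
      ∑ p, ∑ q, (g x)⁻¹ p q * T (Matrix.vecCons p (Matrix.vecCons q a)) x := rfl

/-- A symmetry of a tensor is inherited by its covariant derivative. -/
lemma covDeriv_of_symm {g : MetricField} {U : Set Coord} (hU : IsOpen U) {n : ℕ}
    {T : TensorField n} (hT : SmoothOn T U) (c : ℝ) (σ : Fin n → Fin n)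
    (hσ : Function.Bijective σ) (h : ∀ a, ∀ y ∈ U, T a y = c * T (a ∘ σ) y) {x : Coord}
    (hx : x ∈ U) (i : Fin 4) (a : Fin n → Fin 4) :
    covDeriv g T (Matrix.vecCons i a) x = c * covDeriv g T (Matrix.vecCons i (a ∘ σ)) x := by
  rw [covDeriv_congr hU h hx, covDeriv_const_mul (T := fun a x => T (a ∘ σ) x) hU
    (fun a => hT _) c hx]
  exact congrArg (c * ·) (covDeriv_perm T σ hσ i a)

namespace IsMetricOn

variable {g : MetricField} {U : Set Coord} (hg : IsMetricOn g U) {x : Coord}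
include hg

lemma sum_inv_comm (hx : x ∈ U) (F : Fin 4 → Fin 4 → ℝ) :
    ∑ p, ∑ q, (g x)⁻¹ p q * F p q = ∑ p, ∑ q, (g x)⁻¹ p q * F q p := by
  rw [Finset.sum_comm]
  simp only [hg.inv_symm hx]

lemma ricci_eq (hx : x ∈ U) (a : Fin 2 → Fin 4) :
    ricci g a x = ∑ p, ∑ q, (g x)⁻¹ p q * riemann g p (a 0) q (a 1) x := by
  rw [hg.sum_inv_comm hx]
  exact Finset.sum_congr rfl fun p _ => hg.riemannUp_eq hx _ _ _ _

lemma ricci_symm (hx : x ∈ U) (k l : Fin 4) : ricci g ![k, l] x = ricci g ![l, k] x := by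
  rw [hg.ricci_eq hx, hg.ricci_eq hx, hg.sum_inv_comm hx]
  exact Finset.sum_congr rfl fun p _ => Finset.sum_congr rfl fun q _ => by
    rw [hg.riemann_pair hx]; rfl

/-- Since `contr` acts on the first two slots, the Riemann tensor is first permuted by `![0, 2, 1,
3]`, which brings the traced pair to the front. -/
lemma covDeriv_ricci (hx : x ∈ U) (i k l : Fin 4) : covDeriv g (ricci g) ![i, k, l] x =
    ∑ p, ∑ q, (g x)⁻¹ p q * covDeriv g (riemannTensor g) ![i, p, k, q, l] x := by
  rw [covDeriv_congr hg.isOpen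
    (S := contr g fun a x => riemannTensor g (a ∘ ![0, 2, 1, 3]) x) (fun a y hy => ?_) hx]
  · refine (hg.covDeriv_contr (T := fun a x => riemannTensor g (a ∘ ![0, 2, 1, 3]) x)
      (fun a => hg.smoothOn_riemannTensor _) hx i ![k, l]).trans ?_
    simp only [covDeriv_perm (riemannTensor g) ![0, 2, 1, 3] (by decide)]
    simp [fin_cons_eq_vecCons, comp_vecCons', comp_vecEmpty']
  · exact hg.ricci_eq hy a

lemma covDeriv_ricci_symm (hx : x ∈ U) (i k l : Fin 4) :
    covDeriv g (ricci g) ![i, k, l] x = covDeriv g (ricci g) ![i, l, k] x := by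
  refine (covDeriv_of_symm hg.isOpen hg.smoothOn_ricci 1 ![1, 0] (by decide) (fun a y hy => ?_) hx
    i ![k, l]).trans ?_
  · have : a = ![a 0, a 1] := by ext j; fin_cases j <;> rfl
    rw [one_mul, this, hg.ricci_symm hy]
    simp [comp_vecCons', comp_vecEmpty']
  · simp [comp_vecCons', comp_vecEmpty']

lemma covDeriv_riemann_swap_left (hx : x ∈ U) (e a b c d : Fin 4) :
    covDeriv g (riemannTensor g) ![e, a, b, c, d] x =
      -covDeriv g (riemannTensor g) ![e, b, a, c, d] x := by
  refine (covDeriv_of_symm hg.isOpen hg.smoothOn_riemannTensor (-1) ![1, 0, 2, 3] (by decide)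
    (fun a y hy => ?_) hx e ![a, b, c, d]).trans ?_
  · simpa [riemannTensor] using hg.riemann_swap_left hy _ _ _ _
  · simp [comp_vecCons', comp_vecEmpty']

lemma covDeriv_riemann_swap_right (hx : x ∈ U) (e a b c d : Fin 4) :
    covDeriv g (riemannTensor g) ![e, a, b, c, d] x =
      -covDeriv g (riemannTensor g) ![e, a, b, d, c] x := by
  refine (covDeriv_of_symm hg.isOpen hg.smoothOn_riemannTensor (-1) ![0, 1, 3, 2] (by decide)
    (fun a y hy => ?_) hx e ![a, b, c, d]).trans ?_
  · simpa [riemannTensor] using riemann_swap_right _ _ _ _ _ _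
  · simp [comp_vecCons', comp_vecEmpty']

/-- The contracted second Bianchi identity `∇^a R_{abcd} = ∇_c R_{bd} - ∇_d R_{bc}`. -/
lemma div_riemann (hx : x ∈ U) (b c d : Fin 4) :
    ∑ e, ∑ a, (g x)⁻¹ e a * covDeriv g (riemannTensor g) ![e, a, b, c, d] x =
      covDeriv g (ricci g) ![c, b, d] x - covDeriv g (ricci g) ![d, b, c] x := by
  rw [hg.covDeriv_ricci hx, hg.covDeriv_ricci hx, hg.sum_inv_comm hx
    fun p q => covDeriv g (riemannTensor g) ![c, p, b, q, d] x,
    hg.sum_inv_comm hx fun p q => covDeriv g (riemannTensor g) ![d, p, b, q, c] x]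
  simp only [← Finset.sum_sub_distrib, ← mul_sub]
  refine Finset.sum_congr rfl fun e _ => Finset.sum_congr rfl fun a _ => ?_
  have := hg.covDeriv_riemann_cyclic hx e a b c d
  rw [hg.covDeriv_riemann_swap_right hx c a b d e] at this
  rw [show covDeriv g (riemannTensor g) ![e, a, b, c, d] x =
    covDeriv g (riemannTensor g) ![c, a, b, e, d] x -
    covDeriv g (riemannTensor g) ![d, a, b, e, c] x by linarith]

lemma trace_covDeriv_ricci (hx : x ∈ U) (i : Fin 4) :
    ∑ p, ∑ q, (g x)⁻¹ p q * covDeriv g (ricci g) ![i, p, q] x = pd i (scalarCurv g) x := by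
  have h := hg.covDeriv_contr hg.smoothOn_ricci hx i ![]
  rw [contr_ricci, covDeriv_scalarField] at h
  exact h.symm

/-- The twice contracted second Bianchi identity `∇^k R_{kl} = ½ ∇_l R`. -/
lemma div_ricci (hx : x ∈ U) (l : Fin 4) :
    ∑ p, ∑ q, (g x)⁻¹ p q * covDeriv g (ricci g) ![p, q, l] x =
      1 / 2 * pd l (scalarCurv g) x := by
  -- The same double trace of ∇Riem is evaluated twice: by the once contracted Bianchi identity
  -- here, and in `h2` by the antisymmetries, which turn it into the trace defining ∇Ric.
  have h1 : ∑ b, ∑ d, (g x)⁻¹ b d *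
      ∑ e, ∑ a, (g x)⁻¹ e a * covDeriv g (riemannTensor g) ![e, a, b, l, d] x =
      pd l (scalarCurv g) x -
        ∑ p, ∑ q, (g x)⁻¹ p q * covDeriv g (ricci g) ![p, q, l] x := by
    simp only [hg.div_riemann hx, mul_sub, Finset.sum_sub_distrib, hg.trace_covDeriv_ricci hx]
    rw [hg.sum_inv_comm hx fun b d => covDeriv g (ricci g) ![d, b, l] x]
  have h2 : ∑ b, ∑ d, (g x)⁻¹ b d *
      ∑ e, ∑ a, (g x)⁻¹ e a * covDeriv g (riemannTensor g) ![e, a, b, l, d] x =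
      ∑ p, ∑ q, (g x)⁻¹ p q * covDeriv g (ricci g) ![p, q, l] x := by
    simp only [hg.covDeriv_ricci hx, Finset.mul_sum]
    simp only [← Fintype.sum_prod_type']
    refine Fintype.sum_equiv (Equiv.mk (fun z : Fin 4 × Fin 4 × Fin 4 × Fin 4 =>
      (z.2.2.1, z.2.2.2, z.1, z.2.1)) (fun z => (z.2.2.1, z.2.2.2, z.1, z.2.1))
      (fun _ => rfl) (fun _ => rfl)) _ _ fun z => ?_
    simp only [Equiv.coe_fn_mk]
    rw [hg.covDeriv_riemann_swap_left hx, hg.covDeriv_riemann_swap_right hx]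
    ring
  linarith

end IsMetricOn

/-! ### Commuting covariant derivatives -/

/-- The tensor `R_{km} R_l^m`. -/
def ricciSq (g : MetricField) : TensorField 2 :=
  contr g fun a x => ricci g (a ∘ ![2, 0]) x * ricci g (a ∘ ![3, 1]) x

/-- The tensor `R_{jklm} R^{mj}`. -/
def riemannRicci (g : MetricField) : TensorField 2 :=
  contr g (contr g fun a x => riemannTensor g (a ∘ ![2, 4, 5, 0]) x * ricci g (a ∘ ![1, 3]) x)

/-- The tensor `∇^j ∇_k R_{jl}`. -/
def divCovDerivRicci (g : MetricField) : TensorField 2 :=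
  contr g fun a x => covDeriv g (covDeriv g (ricci g)) (a ∘ ![0, 2, 1, 3]) x

/-- The Hessian `∇_k ∇_l R` of the curvature scalar. -/
def hessScalarCurv (g : MetricField) : TensorField 2 := covDeriv g (grad (scalarCurv g))

/-- The tensor `R_{kl} ∇^k R`. -/
def ricciGrad (g : MetricField) (l : Fin 4) (x : Coord) : ℝ :=
  ∑ p, ∑ q, (g x)⁻¹ p q * (pd p (scalarCurv g) x * ricci g ![l, q] x)

/-- The tensor `R^{pq} ∇_l R_{pq}`. -/
def ricciCovDerivRicci (g : MetricField) (l : Fin 4) (x : Coord) : ℝ :=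
  ∑ p, ∑ q, (g x)⁻¹ p q * ∑ r, ∑ s, (g x)⁻¹ r s *
    (covDeriv g (ricci g) ![l, p, r] x * ricci g ![s, q] x)

/-- The tensor `R^{mj} ∇_m R_{jl}`. -/
def ricciDerivRicci (g : MetricField) (l : Fin 4) (x : Coord) : ℝ :=
  ∑ i, ∑ k, (g x)⁻¹ i k * ∑ p, ∑ q, (g x)⁻¹ p q *
    (ricci g ![k, p] x * covDeriv g (ricci g) ![i, l, q] x)

/-- The tensor `R_{jklm} ∇^k R^{mj}`. -/
def riemannDerivRicci (g : MetricField) (l : Fin 4) (x : Coord) : ℝ :=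
  ∑ i, ∑ k, (g x)⁻¹ i k * ∑ p, ∑ q, (g x)⁻¹ p q * ∑ r, ∑ s, (g x)⁻¹ r s *
    (riemann g p k l r x * covDeriv g (ricci g) ![i, s, q] x)

lemma ricciSq_apply (g : MetricField) (k l : Fin 4) (x : Coord) : ricciSq g ![k, l] x =
    ∑ p, ∑ q, (g x)⁻¹ p q * (ricci g ![k, p] x * ricci g ![l, q] x) := by
  simp [ricciSq, contr_vecCons, comp_vecCons', comp_vecEmpty']

/-- The nested contractions order the slots as (r, s, p, q, k, l), which explains the index lists
`![2, 4, 5, 0]` and `![1, 3]` in the definition. -/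
lemma riemannRicci_apply (g : MetricField) (k l : Fin 4) (x : Coord) :
    riemannRicci g ![k, l] x = ∑ p, ∑ q, (g x)⁻¹ p q * ∑ r, ∑ s, (g x)⁻¹ r s *
      (riemann g p k l r x * ricci g ![s, q] x) := by
  simp [riemannRicci, contr_vecCons, comp_vecCons', comp_vecEmpty', riemannTensor]

lemma divCovDerivRicci_apply (g : MetricField) (k l : Fin 4) (x : Coord) :
    divCovDerivRicci g ![k, l] x = ∑ i, ∑ j, (g x)⁻¹ i j *
      covDeriv g (covDeriv g (ricci g)) ![i, k, j, l] x := by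
  simp [divCovDerivRicci, contr_vecCons, comp_vecCons', comp_vecEmpty']

namespace IsMetricOn

variable {g : MetricField} {U : Set Coord} (hg : IsMetricOn g U) {x : Coord}
include hg

lemma smoothOn_ricciSq : SmoothOn (ricciSq g) U :=
  hg.smoothOn_contr fun _ => (hg.smoothOn_ricci _).mul (hg.smoothOn_ricci _)

lemma smoothOn_riemannRicci : SmoothOn (riemannRicci g) U :=
  hg.smoothOn_contr (hg.smoothOn_contr fun _ =>
    (hg.smoothOn_riemannTensor _).mul (hg.smoothOn_ricci _))

lemma smoothOn_covDeriv_covDeriv_ricci : SmoothOn (covDeriv g (covDeriv g (ricci g))) U :=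
  hg.smoothOn_covDeriv (hg.smoothOn_covDeriv hg.smoothOn_ricci)

lemma smoothOn_divCovDerivRicci : SmoothOn (divCovDerivRicci g) U :=
  hg.smoothOn_contr fun _ => hg.smoothOn_covDeriv_covDeriv_ricci _

lemma smoothOn_grad_scalarCurv : SmoothOn (grad (scalarCurv g)) U :=
  fun _ => contDiffOn_pd hg.isOpen hg.contDiffOn_scalarCurv _

lemma smoothOn_hessScalarCurv : SmoothOn (hessScalarCurv g) U :=
  hg.smoothOn_covDeriv hg.smoothOn_grad_scalarCurv

lemma contDiffOn_laplacian : ContDiffOn ℝ ∞ (laplacian g (scalarCurv g)) U :=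
  hg.smoothOn_contr hg.smoothOn_hessScalarCurv ![]

lemma contr_riemann (hx : x ∈ U) (n l : Fin 4) :
    ∑ i, ∑ j, (g x)⁻¹ i j * riemann g n j i l x = -ricci g ![n, l] x := by
  rw [hg.ricci_eq hx, hg.sum_inv_comm hx, ← Finset.sum_neg_distrib]
  refine Finset.sum_congr rfl fun i _ => ?_
  rw [← Finset.sum_neg_distrib]
  refine Finset.sum_congr rfl fun j _ => ?_
  rw [hg.riemann_swap_left hx, mul_neg]
  rfl

lemma contr_riemannUp (hx : x ∈ U) (m l : Fin 4) :
    ∑ i, ∑ j, (g x)⁻¹ i j * riemannUp g m j i l x = -∑ n, (g x)⁻¹ m n * ricci g ![n, l] x := by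
  simp only [hg.riemannUp_eq hx, Finset.mul_sum]
  rw [← Finset.sum_neg_distrib, Finset.sum_congr rfl fun _ _ => Finset.sum_comm, Finset.sum_comm]
  refine Finset.sum_congr rfl fun n _ => ?_
  rw [← mul_neg, ← hg.contr_riemann hx, Finset.mul_sum]
  refine Finset.sum_congr rfl fun i _ => ?_
  rw [Finset.mul_sum]
  exact Finset.sum_congr rfl fun j _ => by ring

/-- The Ricci identity in rank zero, where there are no slots for curvature to act on. -/
lemma hessScalarCurv_symm (hx : x ∈ U) (k l : Fin 4) :
    hessScalarCurv g ![k, l] x = hessScalarCurv g ![l, k] x := by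
  have h := hg.ricci_identity (T := scalarField (scalarCurv g))
    (fun _ => hg.contDiffOn_scalarCurv) hx k l ![]
  rw [covDeriv_scalarField] at h
  simp only [Finset.univ_eq_empty, Finset.sum_empty, neg_zero] at h
  exact sub_eq_zero.1 h

lemma covDeriv_hessScalarCurv_symm (hx : x ∈ U) (i k l : Fin 4) :
    covDeriv g (hessScalarCurv g) ![i, k, l] x = covDeriv g (hessScalarCurv g) ![i, l, k] x := by
  refine (covDeriv_of_symm hg.isOpen hg.smoothOn_hessScalarCurv 1 ![1, 0] (by decide)
    (fun a y hy => ?_) hx i ![k, l]).trans ?_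
  · have : a = ![a 0, a 1] := by ext j; fin_cases j <;> rfl
    rw [one_mul, this, hg.hessScalarCurv_symm hy]
    simp [comp_vecCons', comp_vecEmpty']
  · simp [comp_vecCons', comp_vecEmpty']

/-- `∇^k ∇_k ∇_l R = ∇_l ∇² R + R_{lk} ∇^k R`. -/
lemma div_hessScalarCurv (hx : x ∈ U) (l : Fin 4) : divergence g (hessScalarCurv g) ![l] x =
    pd l (laplacian g (scalarCurv g)) x + ricciGrad g l x := by
  have h1 : ∑ i, ∑ j, (g x)⁻¹ i j * covDeriv g (hessScalarCurv g) ![l, i, j] x =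
      pd l (laplacian g (scalarCurv g)) x := by
    have h := hg.covDeriv_contr hg.smoothOn_hessScalarCurv hx l ![]
    have e : contr g (hessScalarCurv g) = scalarField (laplacian g (scalarCurv g)) := by
      funext a
      rw [Subsingleton.elim a ![]]
      rfl
    rw [e, covDeriv_scalarField] at h
    exact h.symm
  -- Symmetry of the Hessian puts l in a derivative position; commuting ∇_i with ∇_l then costs one
  -- curvature term, whose trace `h3` is -R_{lk}∇^kR.
  have h2 (i j : Fin 4) : covDeriv g (hessScalarCurv g) ![i, j, l] x =
      covDeriv g (hessScalarCurv g) ![l, i, j] x -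
        ∑ m, riemannUp g m j i l x * pd m (scalarCurv g) x := by
    rw [hg.covDeriv_hessScalarCurv_symm hx]
    have h := hg.ricci_identity hg.smoothOn_grad_scalarCurv hx i l ![j]
    simp only [Fin.sum_univ_one] at h
    have : ∑ m, riemannUp g m j i l x * pd m (scalarCurv g) x =
      ∑ m, riemannUp g m (![j] 0) i l x * grad (scalarCurv g) (Function.update ![j] 0 m) x := by
      simp [grad]
    rw [this]
    have h' : covDeriv g (hessScalarCurv g) ![i, l, j] x -
      covDeriv g (hessScalarCurv g) ![l, i, j] x = _ := h
    linarith
  have h3 : ∑ i, ∑ j, (g x)⁻¹ i j * ∑ m, riemannUp g m j i l x * pd m (scalarCurv g) x =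
      -ricciGrad g l x := by
    have : ∑ i, ∑ j, (g x)⁻¹ i j * ∑ m, riemannUp g m j i l x * pd m (scalarCurv g) x =
        ∑ m, (∑ i, ∑ j, (g x)⁻¹ i j * riemannUp g m j i l x) * pd m (scalarCurv g) x := by
      simp only [Finset.mul_sum, Finset.sum_mul]
      rw [Finset.sum_congr rfl fun _ _ => Finset.sum_comm, Finset.sum_comm]
      simp only [mul_assoc]
    rw [this, ricciGrad, ← Finset.sum_neg_distrib]
    refine Finset.sum_congr rfl fun m _ => ?_
    rw [hg.contr_riemannUp hx, neg_mul, Finset.sum_mul]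
    congr 1
    exact Finset.sum_congr rfl fun n _ => by rw [hg.ricci_symm hx n l]; ring
  rw [divergence_eq_contr, contr_vecCons]
  simp only [h2, mul_sub, Finset.sum_sub_distrib, h1, h3]
  ring

/-- The covariant derivative of the twice contracted Bianchi identity, with ∇_k taken inside the
trace. -/
lemma covDeriv_div_ricci (hx : x ∈ U) (k l : Fin 4) :
    ∑ i, ∑ j, (g x)⁻¹ i j * covDeriv g (covDeriv g (ricci g)) ![k, i, j, l] x =
      1 / 2 * hessScalarCurv g ![k, l] x := by
  refine (hg.covDeriv_contr (hg.smoothOn_covDeriv hg.smoothOn_ricci) hx k ![l]).symm.trans ?_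
  rw [covDeriv_congr hg.isOpen (S := fun a x => 1 / 2 * grad (scalarCurv g) a x)
    (fun a y hy => ?_) hx, covDeriv_const_mul hg.isOpen hg.smoothOn_grad_scalarCurv _ hx]
  · rfl
  · have : a = ![a 0] := by ext j; fin_cases j; rfl
    rw [this]
    exact hg.div_ricci hy _

/-- `∇^j ∇_k R_{jl} = ½ ∇_k ∇_l R + R_{km} R_l^m + R_{jklm} R^{mj}`. -/
lemma divCovDerivRicci_eq (hx : x ∈ U) (k l : Fin 4) : divCovDerivRicci g ![k, l] x =
    1 / 2 * hessScalarCurv g ![k, l] x + ricciSq g ![k, l] x + riemannRicci g ![k, l] x := by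
  -- Commuting ∇_i past ∇_k exposes the divergence of Ric. After tracing over i and j, curvature
  -- acting on the slot j gives the Ricci square (`h3`), and on the slot l the Riemann-Ricci term
  -- (`h4`).
  have h2 (i j : Fin 4) : covDeriv g (covDeriv g (ricci g)) ![i, k, j, l] x =
      covDeriv g (covDeriv g (ricci g)) ![k, i, j, l] x -
        ∑ m, riemannUp g m j i k x * ricci g ![m, l] x -
        ∑ m, riemannUp g m l i k x * ricci g ![j, m] x := by
    have h := hg.ricci_identity hg.smoothOn_ricci hx i k ![j, l]
    simp only [Fin.sum_univ_two] at h
    have e1 : Function.update ![j, l] 0 = fun m => ![m, l] := by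
      funext m; ext s; fin_cases s <;> rfl
    have e2 : Function.update ![j, l] 1 = fun m => ![j, m] := by
      funext m; ext s; fin_cases s <;> rfl
    rw [e1, e2] at h
    simp only [fin_cons_eq_vecCons, Matrix.cons_val_zero, Matrix.cons_val_one] at h
    linarith
  have h3 : ∑ i, ∑ j, (g x)⁻¹ i j * ∑ m, riemannUp g m j i k x * ricci g ![m, l] x =
      -ricciSq g ![k, l] x := by
    have : ∑ i, ∑ j, (g x)⁻¹ i j * ∑ m, riemannUp g m j i k x * ricci g ![m, l] x =
        ∑ m, (∑ i, ∑ j, (g x)⁻¹ i j * riemannUp g m j i k x) * ricci g ![m, l] x := by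
      simp only [Finset.mul_sum, Finset.sum_mul]
      rw [Finset.sum_congr rfl fun _ _ => Finset.sum_comm, Finset.sum_comm]
      simp only [mul_assoc]
    rw [this, ricciSq_apply, hg.sum_inv_comm hx, ← Finset.sum_neg_distrib]
    refine Finset.sum_congr rfl fun m _ => ?_
    rw [hg.contr_riemannUp hx, neg_mul, Finset.sum_mul]
    congr 1
    exact Finset.sum_congr rfl fun n _ => by
      rw [hg.ricci_symm hx n k, hg.ricci_symm hx m l]; ring
  have h4 : ∑ i, ∑ j, (g x)⁻¹ i j * ∑ m, riemannUp g m l i k x * ricci g ![j, m] x =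
      -riemannRicci g ![k, l] x := by
    rw [riemannRicci_apply, ← Finset.sum_neg_distrib]
    refine Finset.sum_congr rfl fun i _ => ?_
    rw [← Finset.sum_neg_distrib]
    refine Finset.sum_congr rfl fun j _ => ?_
    rw [← mul_neg, hg.sum_inv_comm hx, ← Finset.sum_neg_distrib]
    congr 1
    refine Finset.sum_congr rfl fun m _ => ?_
    rw [hg.riemannUp_eq hx, Finset.sum_mul, ← Finset.sum_neg_distrib]
    refine Finset.sum_congr rfl fun n _ => ?_
    rw [hg.riemann_pair hx i k, riemann_swap_right g l n i k,
      hg.riemann_swap_left hx l n k i, riemann_swap_right g n l i k, hg.ricci_symm hx j m]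
    ring
  rw [divCovDerivRicci_apply]
  simp only [h2, mul_sub, Finset.sum_sub_distrib, h3, h4, hg.covDeriv_div_ricci hx]
  ring

/-- `∇^k (R_{km} R_l^m) = ½ R_{kl} ∇^k R + R^{mj} ∇_m R_{jl}`. -/
lemma div_ricciSq (hx : x ∈ U) (l : Fin 4) : divergence g (ricciSq g) ![l] x =
    1 / 2 * ricciGrad g l x + ricciDerivRicci g l x := by
  have h (i k : Fin 4) : covDeriv g (ricciSq g) ![i, k, l] x = ∑ p, ∑ q, (g x)⁻¹ p q *
      (covDeriv g (ricci g) ![i, k, p] x * ricci g ![l, q] x +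
        ricci g ![k, p] x * covDeriv g (ricci g) ![i, l, q] x) := by
    refine (hg.covDeriv_contr
      (T := fun a x => ricci g (a ∘ ![2, 0]) x * ricci g (a ∘ ![3, 1]) x)
      (fun _ => (hg.smoothOn_ricci _).mul (hg.smoothOn_ricci _)) hx i ![k, l]).trans ?_
    simp only [covDeriv_mul hg.isOpen hg.smoothOn_ricci hg.smoothOn_ricci hx (N := 4) ![2, 0] ![3, 1]
      (by decide)]
    simp [fin_cons_eq_vecCons, comp_vecCons', comp_vecEmpty']
  have h1 : ∑ i, ∑ k, (g x)⁻¹ i k * ∑ p, ∑ q, (g x)⁻¹ p q *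
      (covDeriv g (ricci g) ![i, k, p] x * ricci g ![l, q] x) = 1 / 2 * ricciGrad g l x := by
    have h2 (p : Fin 4) := hg.div_ricci hx p
    have : ∑ i, ∑ k, (g x)⁻¹ i k * ∑ p, ∑ q, (g x)⁻¹ p q *
        (covDeriv g (ricci g) ![i, k, p] x * ricci g ![l, q] x) = ∑ p, ∑ q, (g x)⁻¹ p q *
        ((∑ i, ∑ k, (g x)⁻¹ i k * covDeriv g (ricci g) ![i, k, p] x) * ricci g ![l, q] x) := by
      simp only [Finset.mul_sum, Finset.sum_mul]
      simp only [← Fintype.sum_prod_type']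
      refine Fintype.sum_equiv (Equiv.mk (fun z : Fin 4 × Fin 4 × Fin 4 × Fin 4 =>
        (z.2.2.1, z.2.2.2, z.1, z.2.1)) (fun z => (z.2.2.1, z.2.2.2, z.1, z.2.1))
        (fun _ => rfl) (fun _ => rfl)) _ _ fun z => ?_
      simp only [Equiv.coe_fn_mk]
      ring
    rw [this]
    simp only [h2, ricciGrad, Finset.mul_sum]
    exact Finset.sum_congr rfl fun _ _ => Finset.sum_congr rfl fun _ _ => by ring
  rw [divergence_eq_contr, contr_vecCons]
  simp only [h, mul_add, Finset.sum_add_distrib]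
  rw [h1, ricciDerivRicci]

/-- `∇^k (R_{jklm} R^{mj})`, by the contracted second Bianchi identity. -/
lemma div_riemannRicci (hx : x ∈ U) (l : Fin 4) : divergence g (riemannRicci g) ![l] x =
    -ricciCovDerivRicci g l x + ricciDerivRicci g l x + riemannDerivRicci g l x := by
  have h (i k : Fin 4) : covDeriv g (riemannRicci g) ![i, k, l] x =
      ∑ p, ∑ q, (g x)⁻¹ p q * ∑ r, ∑ s, (g x)⁻¹ r s *
        (covDeriv g (riemannTensor g) ![i, p, k, l, r] x * ricci g ![s, q] x +
          riemann g p k l r x * covDeriv g (ricci g) ![i, s, q] x) := by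
    have hs : SmoothOn (fun (a : Fin 6 → Fin 4) x =>
        riemannTensor g (a ∘ ![2, 4, 5, 0]) x * ricci g (a ∘ ![1, 3]) x) U :=
      fun _ => (hg.smoothOn_riemannTensor _).mul (hg.smoothOn_ricci _)
    refine (hg.covDeriv_contr (hg.smoothOn_contr hs) hx i ![k, l]).trans ?_
    simp only [hg.covDeriv_contr hs hx]
    simp only [covDeriv_mul hg.isOpen hg.smoothOn_riemannTensor hg.smoothOn_ricci hx
      (N := 6) ![2, 4, 5, 0] ![1, 3] (by decide)]
    simp [fin_cons_eq_vecCons, comp_vecCons', comp_vecEmpty', riemannTensor]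
  have h1 : ∑ i, ∑ k, (g x)⁻¹ i k * ∑ p, ∑ q, (g x)⁻¹ p q * ∑ r, ∑ s, (g x)⁻¹ r s *
      (covDeriv g (riemannTensor g) ![i, p, k, l, r] x * ricci g ![s, q] x) =
      -ricciCovDerivRicci g l x + ricciDerivRicci g l x := by
    -- The divergence falls on the second slot of Riem, so antisymmetry in the first pair precedes
    -- the contracted Bianchi identity and reverses its sign.
    have h2 (p r : Fin 4) :
        ∑ i, ∑ k, (g x)⁻¹ i k * covDeriv g (riemannTensor g) ![i, p, k, l, r] x =
        covDeriv g (ricci g) ![r, p, l] x - covDeriv g (ricci g) ![l, p, r] x := by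
      rw [← neg_sub, ← hg.div_riemann hx, ← Finset.sum_neg_distrib]
      simp only [hg.covDeriv_riemann_swap_left hx _ p, mul_neg, Finset.sum_neg_distrib]
    have h3 : ∑ i, ∑ k, (g x)⁻¹ i k * ∑ p, ∑ q, (g x)⁻¹ p q * ∑ r, ∑ s, (g x)⁻¹ r s *
        (covDeriv g (riemannTensor g) ![i, p, k, l, r] x * ricci g ![s, q] x) =
        ∑ p, ∑ q, (g x)⁻¹ p q * ∑ r, ∑ s, (g x)⁻¹ r s *
        ((∑ i, ∑ k, (g x)⁻¹ i k * covDeriv g (riemannTensor g) ![i, p, k, l, r] x) *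
          ricci g ![s, q] x) := by
      simp only [Finset.mul_sum, Finset.sum_mul]
      simp only [← Fintype.sum_prod_type']
      refine Fintype.sum_equiv (Equiv.mk
        (fun z : Fin 4 × Fin 4 × Fin 4 × Fin 4 × Fin 4 × Fin 4 =>
          (z.2.2.1, z.2.2.2.1, z.2.2.2.2.1, z.2.2.2.2.2, z.1, z.2.1))
        (fun z => (z.2.2.2.2.1, z.2.2.2.2.2, z.1, z.2.1, z.2.2.1, z.2.2.2.1))
        (fun _ => rfl) (fun _ => rfl)) _ _ fun z => ?_
      simp only [Equiv.coe_fn_mk]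
      ring
    have h4 : ∑ p, ∑ q, (g x)⁻¹ p q * ∑ r, ∑ s, (g x)⁻¹ r s *
        (covDeriv g (ricci g) ![r, p, l] x * ricci g ![s, q] x) = ricciDerivRicci g l x := by
      rw [hg.sum_inv_comm hx, ricciDerivRicci]
      simp only [Finset.mul_sum]
      simp only [← Fintype.sum_prod_type']
      refine Fintype.sum_equiv (Equiv.mk (fun z : Fin 4 × Fin 4 × Fin 4 × Fin 4 =>
        (z.2.2.1, z.2.2.2, z.1, z.2.1)) (fun z => (z.2.2.1, z.2.2.2, z.1, z.2.1))
        (fun _ => rfl) (fun _ => rfl)) _ _ fun z => ?_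
      simp only [Equiv.coe_fn_mk]
      rw [hg.covDeriv_ricci_symm hx _ _ l]
      ring
    rw [h3]
    simp only [h2, sub_mul, mul_sub, Finset.sum_sub_distrib]
    rw [← h4, ricciCovDerivRicci]
    ring
  rw [divergence_eq_contr, contr_vecCons]
  simp only [h, mul_add, Finset.sum_add_distrib]
  rw [h1, riemannDerivRicci]

/-- `∇^k ∇^j ∇_j R_{kl} = ∇^k ∇^j ∇_k R_{jl} + R_{jklm} ∇^k R^{mj}`. -/
lemma div_laplacian_ricci (hx : x ∈ U) (l : Fin 4) :
    divergence g (contr g (covDeriv g (covDeriv g (ricci g)))) ![l] x =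
      divergence g (divCovDerivRicci g) ![l] x + riemannDerivRicci g l x := by
  set T := covDeriv g (ricci g)
  have hT : SmoothOn T U := hg.smoothOn_covDeriv hg.smoothOn_ricci
  have hW (c k : Fin 4) : covDeriv g (divCovDerivRicci g) ![c, k, l] x =
      ∑ i, ∑ j, (g x)⁻¹ i j * covDeriv g (covDeriv g T) ![c, i, k, j, l] x := by
    refine (hg.covDeriv_contr
      (T := fun a x => covDeriv g (covDeriv g (ricci g)) (a ∘ ![0, 2, 1, 3]) x)
      (fun a => hg.smoothOn_covDeriv_covDeriv_ricci _) hx c ![k, l]).trans ?_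
    refine Finset.sum_congr rfl fun i _ => Finset.sum_congr rfl fun j _ =>
      congrArg ((g x)⁻¹ i j * ·) ?_
    refine (covDeriv_perm (n := 4) (covDeriv g (covDeriv g (ricci g))) ![0, 2, 1, 3]
      (by decide) c _).trans ?_
    have : (![i, j, k, l] ∘ ![0, 2, 1, 3] : Fin 4 → Fin 4) = ![i, k, j, l] := by
      ext s; fin_cases s <;> rfl
    exact congrArg (fun b => covDeriv g (covDeriv g T) (Fin.cons c b) x) this
  -- The Ricci identity for the rank three tensor ∇Ric: three curvature terms, one for each of its
  -- slots.
  have hcomm (c i j k : Fin 4) : covDeriv g (covDeriv g T) ![c, i, j, k, l] x =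
      covDeriv g (covDeriv g T) ![i, c, j, k, l] x -
        ∑ m, riemannUp g m j c i x * T ![m, k, l] x -
        ∑ m, riemannUp g m k c i x * T ![j, m, l] x -
        ∑ m, riemannUp g m l c i x * T ![j, k, m] x := by
    have h := hg.ricci_identity (n := 3) hT hx c i ![j, k, l]
    simp only [Fin.sum_univ_three] at h
    have e1 : Function.update ![j, k, l] 0 = fun m => ![m, k, l] := by
      funext m; ext s; fin_cases s <;> rfl
    have e2 : Function.update ![j, k, l] 1 = fun m => ![j, m, l] := by
      funext m; ext s; fin_cases s <;> rfl
    have e3 : Function.update ![j, k, l] 2 = fun m => ![j, k, m] := by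
      funext m; ext s; fin_cases s <;> rfl
    rw [e1, e2, e3] at h
    simp only [fin_cons_eq_vecCons, Matrix.cons_val_zero, Matrix.cons_val_one,
      Matrix.cons_val] at h
    linarith
  have hB (c k : Fin 4) : covDeriv g (contr g (covDeriv g T)) ![c, k, l] x =
      ∑ i, ∑ j, (g x)⁻¹ i j * (covDeriv g (covDeriv g T) ![i, c, j, k, l] x -
        ∑ m, riemannUp g m j c i x * T ![m, k, l] x -
        ∑ m, riemannUp g m k c i x * T ![j, m, l] x -
        ∑ m, riemannUp g m l c i x * T ![j, k, m] x) :=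
    (hg.covDeriv_contr (hg.smoothOn_covDeriv hT) hx c ![k, l]).trans
      (Finset.sum_congr rfl fun i _ => Finset.sum_congr rfl fun j _ =>
        congrArg ((g x)⁻¹ i j * ·) (hcomm c i j k))
  -- With the outer derivatives exchanged, renaming the two traced pairs identifies the leading term
  -- with the divergence of W.
  have s0 : ∑ c, ∑ k, (g x)⁻¹ c k * ∑ i, ∑ j, (g x)⁻¹ i j *
      covDeriv g (covDeriv g T) ![i, c, j, k, l] x =
      ∑ c, ∑ k, (g x)⁻¹ c k * ∑ i, ∑ j, (g x)⁻¹ i j *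
        covDeriv g (covDeriv g T) ![c, i, k, j, l] x := by
    simp only [Finset.mul_sum]
    simp only [← Fintype.sum_prod_type']
    refine Fintype.sum_equiv (Equiv.mk (fun z : Fin 4 × Fin 4 × Fin 4 × Fin 4 =>
      (z.2.2.1, z.2.2.2, z.1, z.2.1)) (fun z => (z.2.2.1, z.2.2.2, z.1, z.2.1))
      (fun _ => rfl) (fun _ => rfl)) _ _ fun z => ?_
    simp only [Equiv.coe_fn_mk]
    ring
  -- Curvature acting on the derivative slot and on the first slot of Ric produces the same
  -- contraction of Ric with ∇Ric, with opposite signs.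
  have s12 : ∑ c, ∑ k, (g x)⁻¹ c k * ∑ i, ∑ j, (g x)⁻¹ i j *
      ∑ m, riemannUp g m j c i x * T ![m, k, l] x +
      ∑ c, ∑ k, (g x)⁻¹ c k * ∑ i, ∑ j, (g x)⁻¹ i j *
      ∑ m, riemannUp g m k c i x * T ![j, m, l] x = 0 := by
    have t1 : ∑ c, ∑ k, (g x)⁻¹ c k * ∑ i, ∑ j, (g x)⁻¹ i j *
        ∑ m, riemannUp g m j c i x * T ![m, k, l] x =
        ∑ c, ∑ k, (g x)⁻¹ c k * ∑ m, ∑ n, (g x)⁻¹ m n * (ricci g ![n, c] x * T ![m, k, l] x) := by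
      refine Finset.sum_congr rfl fun c _ => Finset.sum_congr rfl fun k _ => ?_
      congr 1
      have : ∑ i, ∑ j, (g x)⁻¹ i j * ∑ m, riemannUp g m j c i x * T ![m, k, l] x =
          ∑ m, -(∑ i, ∑ j, (g x)⁻¹ i j * riemannUp g m j i c x) * T ![m, k, l] x := by
        simp only [Finset.mul_sum, Finset.sum_mul, ← Finset.sum_neg_distrib]
        rw [Finset.sum_congr rfl fun _ _ => Finset.sum_comm, Finset.sum_comm]
        refine Finset.sum_congr rfl fun m _ => Finset.sum_congr rfl fun i _ =>
          Finset.sum_congr rfl fun j _ => ?_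
        rw [riemannUp_swap g m j c i]
        ring
      rw [this]
      simp only [hg.contr_riemannUp hx, neg_neg, Finset.sum_mul, mul_assoc]
    have t2 : ∑ c, ∑ k, (g x)⁻¹ c k * ∑ i, ∑ j, (g x)⁻¹ i j *
        ∑ m, riemannUp g m k c i x * T ![j, m, l] x =
        -∑ i, ∑ j, (g x)⁻¹ i j * ∑ m, ∑ n, (g x)⁻¹ m n *
          (ricci g ![n, i] x * T ![j, m, l] x) := by
      have : ∑ c, ∑ k, (g x)⁻¹ c k * ∑ i, ∑ j, (g x)⁻¹ i j *
          ∑ m, riemannUp g m k c i x * T ![j, m, l] x = ∑ i, ∑ j, (g x)⁻¹ i j *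
          ∑ m, (∑ c, ∑ k, (g x)⁻¹ c k * riemannUp g m k c i x) * T ![j, m, l] x := by
        simp only [Finset.mul_sum, Finset.sum_mul]
        simp only [← Fintype.sum_prod_type']
        refine Fintype.sum_equiv (Equiv.mk
          (fun z : Fin 4 × Fin 4 × Fin 4 × Fin 4 × Fin 4 =>
            (z.2.2.1, z.2.2.2.1, z.2.2.2.2, z.1, z.2.1))
          (fun z => (z.2.2.2.1, z.2.2.2.2, z.1, z.2.1, z.2.2.1))
          (fun _ => rfl) (fun _ => rfl)) _ _ fun z => ?_
        simp only [Equiv.coe_fn_mk]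
        ring
      rw [this]
      simp only [hg.contr_riemannUp hx, neg_mul, Finset.sum_neg_distrib, mul_neg, Finset.sum_mul,
        mul_assoc]
    rw [t1, t2, ← sub_eq_add_neg, sub_eq_zero]
    simp only [Finset.mul_sum]
    simp only [← Fintype.sum_prod_type']
    refine Fintype.sum_equiv (Equiv.mk (fun z : Fin 4 × Fin 4 × Fin 4 × Fin 4 =>
      (z.2.2.2, z.2.2.1, z.2.1, z.1)) (fun z => (z.2.2.2, z.2.2.1, z.2.1, z.1))
      (fun _ => rfl) (fun _ => rfl)) _ _ fun z => ?_
    simp only [Equiv.coe_fn_mk]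
    rw [hg.inv_symm hx z.2.2.2, hg.inv_symm hx z.2.1, hg.ricci_symm hx z.1]
    ring
  -- The surviving curvature term acts on the free index l.
  have s3 : ∑ c, ∑ k, (g x)⁻¹ c k * ∑ i, ∑ j, (g x)⁻¹ i j *
      ∑ m, riemannUp g m l c i x * T ![j, k, m] x = -riemannDerivRicci g l x := by
    rw [riemannDerivRicci, hg.sum_inv_comm hx (fun i k => ∑ p, ∑ q, (g x)⁻¹ p q *
      ∑ r, ∑ s, (g x)⁻¹ r s * (riemann g p k l r x * covDeriv g (ricci g) ![i, s, q] x))]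
    simp only [hg.riemannUp_eq hx, Finset.mul_sum, Finset.sum_mul, ← Finset.sum_neg_distrib]
    simp only [← Fintype.sum_prod_type']
    refine Fintype.sum_equiv (Equiv.mk
      (fun z : Fin 4 × Fin 4 × Fin 4 × Fin 4 × Fin 4 × Fin 4 =>
        (z.2.2.1, z.2.2.2.1, z.1, z.2.1, z.2.2.2.2.2, z.2.2.2.2.1))
      (fun z => (z.2.2.1, z.2.2.2.1, z.1, z.2.1, z.2.2.2.2.2, z.2.2.2.2.1))
      (fun _ => rfl) (fun _ => rfl)) _ _ fun z => ?_
    simp only [Equiv.coe_fn_mk]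
    rw [hg.covDeriv_ricci_symm hx _ z.2.2.2.2.1, hg.inv_symm hx z.2.2.2.2.2,
      hg.riemann_pair hx z.1 _ l, hg.riemann_swap_left hx l]
    ring
  rw [divergence_eq_contr, divergence_eq_contr, contr_vecCons, contr_vecCons]
  simp only [hB, hW, mul_sub, Finset.sum_sub_distrib, s0, s3]
  linarith

end IsMetricOn

/-! ### The divergence identity for Harada's tensor -/

/-- The scalar `R_{pq} R^{pq}`. -/
def ricciNormSq (g : MetricField) : Coord → ℝ :=
  contr g (contr g fun a x => ricci g (a ∘ ![2, 0]) x * ricci g (a ∘ ![1, 3]) x) ![]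

lemma ricciNormSq_apply (g : MetricField) (x : Coord) : ricciNormSq g x =
    ∑ p, ∑ q, (g x)⁻¹ p q * ∑ r, ∑ s, (g x)⁻¹ r s * (ricci g ![p, r] x * ricci g ![s, q] x) := by
  simp [ricciNormSq, contr_vecCons, comp_vecCons', comp_vecEmpty']

/-- The coefficient of the metric in the tensor `Φ`, written with the Ricci tensor. -/
def phiTrace (g : MetricField) (x : Coord) : ℝ :=
  1 / 2 * ricciNormSq g x - 1 / 3 * scalarCurv g x ^ 2 + 1 / 2 * laplacian g (scalarCurv g) x

lemma eq_vec_two (a : Fin 2 → Fin 4) : a = ![a 0, a 1] := by ext j; fin_cases j <;> rfl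

lemma eq_vec_one (a : Fin 1 → Fin 4) : a = ![a 0] := by ext j; fin_cases j; rfl

/-! ### Linearity of the divergence. -/

section Divergence

variable {g : MetricField} {U : Set Coord} {x : Coord} {n : ℕ} {T S : TensorField (n + 1)}

lemma divergence_congr (hU : IsOpen U) (h : ∀ a, ∀ y ∈ U, T a y = S a y) (hx : x ∈ U)
    (a : Fin n → Fin 4) : divergence g T a x = divergence g S a x := by
  simp only [divergence, covDeriv_congr hU h hx]

lemma divergence_add (hU : IsOpen U) (hT : SmoothOn T U) (hS : SmoothOn S U) (hx : x ∈ U)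
    (a : Fin n → Fin 4) : divergence g (fun a x => T a x + S a x) a x =
      divergence g T a x + divergence g S a x := by
  simp only [divergence, covDeriv_add hU hT hS hx, mul_add, Finset.sum_add_distrib]

lemma divergence_const_mul (hU : IsOpen U) (hT : SmoothOn T U) (c : ℝ) (hx : x ∈ U)
    (a : Fin n → Fin 4) :
    divergence g (fun a x => c * T a x) a x = c * divergence g T a x := by
  simp only [divergence, covDeriv_const_mul hU hT c hx, Finset.mul_sum, mul_left_comm c]

lemma divergence_zero (a : Fin n → Fin 4) :
    divergence g (fun (_ : Fin (n + 1) → Fin 4) _ => 0) a x = 0 := by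
  simp [divergence, covDeriv, pd_const]

end Divergence

lemma SmoothOn.add {U : Set Coord} {n : ℕ} {T S : TensorField n} (hT : SmoothOn T U)
    (hS : SmoothOn S U) : SmoothOn (fun a x => T a x + S a x) U := fun a => (hT a).add (hS a)

lemma SmoothOn.const_mul {U : Set Coord} {n : ℕ} {T : TensorField n} (c : ℝ)
    (hT : SmoothOn T U) : SmoothOn (fun a x => c * T a x) U :=
  fun a => contDiffOn_const.mul (hT a)

lemma SmoothOn.mul_fun {U : Set Coord} {n : ℕ} {T : TensorField n} {f : Coord → ℝ}
    (hT : SmoothOn T U) (hf : ContDiffOn ℝ ∞ f U) : SmoothOn (fun a x => T a x * f x) U :=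
  fun a => (hT a).mul hf

/-! ### The tensor Φ and its divergence. -/

namespace IsMetricOn

variable {g : MetricField} {U : Set Coord} (hg : IsMetricOn g U) {x : Coord}
include hg

lemma contDiffOn_ricciNormSq : ContDiffOn ℝ ∞ (ricciNormSq g) U :=
  hg.smoothOn_contr (hg.smoothOn_contr fun _ =>
    (hg.smoothOn_ricci _).mul (hg.smoothOn_ricci _)) ![]

lemma contDiffOn_phiTrace : ContDiffOn ℝ ∞ (phiTrace g) U :=
  ((contDiffOn_const.mul hg.contDiffOn_ricciNormSq).sub
    (contDiffOn_const.mul (hg.contDiffOn_scalarCurv.pow 2))).add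
      (contDiffOn_const.mul hg.contDiffOn_laplacian)

lemma pd_ricciNormSq (hx : x ∈ U) (l : Fin 4) :
    pd l (ricciNormSq g) x = 2 * ricciCovDerivRicci g l x := by
  have hs : SmoothOn (fun (a : Fin 4 → Fin 4) x =>
      ricci g (a ∘ ![2, 0]) x * ricci g (a ∘ ![1, 3]) x) U :=
    fun _ => (hg.smoothOn_ricci _).mul (hg.smoothOn_ricci _)
  have h := hg.covDeriv_contr (hg.smoothOn_contr hs) hx l ![]
  have e : contr g (contr g fun a x => ricci g (a ∘ ![2, 0]) x * ricci g (a ∘ ![1, 3]) x) =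
      scalarField (ricciNormSq g) := by
    funext a
    rw [Subsingleton.elim a ![]]
    rfl
  rw [e, covDeriv_scalarField] at h
  refine (show pd l (ricciNormSq g) x = _ from h).trans ?_
  simp only [hg.covDeriv_contr hs hx]
  simp only [covDeriv_mul hg.isOpen hg.smoothOn_ricci hg.smoothOn_ricci hx (N := 4) ![2, 0] ![1, 3]
      (by decide)]
  simp only [fin_cons_eq_vecCons, comp_vecCons', comp_vecEmpty', Matrix.cons_val_zero,
    Matrix.cons_val_one, Matrix.cons_val, mul_add, Finset.sum_add_distrib]
  -- By symmetry of Ric the two product-rule terms coincide, hence the factor 2.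
  have e2 : ∑ p, ∑ q, (g x)⁻¹ p q * ∑ r, ∑ s, (g x)⁻¹ r s *
      (ricci g ![p, r] x * covDeriv g (ricci g) ![l, s, q] x) = ricciCovDerivRicci g l x := by
    rw [ricciCovDerivRicci, hg.sum_inv_comm hx]
    refine Finset.sum_congr rfl fun p _ => Finset.sum_congr rfl fun q _ => ?_
    rw [hg.sum_inv_comm hx]
    congr 1
    refine Finset.sum_congr rfl fun r _ => Finset.sum_congr rfl fun s _ => ?_
    rw [hg.covDeriv_ricci_symm hx, hg.ricci_symm hx]
    ring
  rw [e2, two_mul]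
  rfl

lemma pd_phiTrace (hx : x ∈ U) (l : Fin 4) : pd l (phiTrace g) x =
    ricciCovDerivRicci g l x - 2 / 3 * scalarCurv g x * pd l (scalarCurv g) x +
      1 / 2 * pd l (laplacian g (scalarCurv g)) x := by
  have h1 := differentiableAt_of_contDiffOn hg.isOpen hg.contDiffOn_ricciNormSq hx
  have h2 := differentiableAt_of_contDiffOn hg.isOpen hg.contDiffOn_scalarCurv hx
  have h3 := differentiableAt_of_contDiffOn hg.isOpen hg.contDiffOn_laplacian hx
  have hc := fun c : ℝ => differentiableAt_const (𝕜 := ℝ) (x := x) c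
  have e : phiTrace g = fun x => 1 / 2 * ricciNormSq g x -
      1 / 3 * (scalarCurv g x * scalarCurv g x) + 1 / 2 * laplacian g (scalarCurv g) x := by
    funext y
    rw [phiTrace, pow_two]
  rw [e, pd_add (((hc _).fun_mul h1).fun_sub ((hc _).fun_mul (h2.fun_mul h2)))
    ((hc _).fun_mul h3), pd_sub ((hc _).fun_mul h1) ((hc _).fun_mul (h2.fun_mul h2)),
    pd_mul (hc _) h1, pd_mul (hc _) (h2.fun_mul h2), pd_mul h2 h2, pd_mul (hc _) h3,
    hg.pd_ricciNormSq hx]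
  simp only [pd_const]
  ring

lemma sum_inv_metric_right (hx : x ∈ U) (k : Fin 4) (v : Fin 4 → ℝ) :
    ∑ p, ∑ q, (g x)⁻¹ p q * (g x q k * v p) = v k := by
  simp only [← mul_assoc, ← Finset.sum_mul, hg.inv_mul hx]
  simp

lemma divergence_metric_mul {f : Coord → ℝ} (hf : ContDiffOn ℝ ∞ f U) (hx : x ∈ U) (l : Fin 4) :
    divergence g (fun a x => metric g a x * f x) ![l] x = pd l f x := by
  have h (i k : Fin 4) : covDeriv g (fun a x => metric g a x * f x) ![i, k, l] x =
      g x k l * pd i f x := by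
    refine (covDeriv_mul hg.isOpen hg.smoothOn_metric (S := scalarField f) (fun _ => hf) hx
      (N := 2) ![0, 1] ![] (by decide) i ![k, l]).trans ?_
    rw [hg.covDeriv_metric hx, covDeriv_scalarField, zero_mul, zero_add]
    rfl
  rw [divergence_eq_contr, contr_vecCons]
  simp only [h]
  exact hg.sum_inv_metric_right hx l fun i => pd i f x

lemma divergence_ricci_mul (hx : x ∈ U) (l : Fin 4) :
    divergence g (fun a x => ricci g a x * scalarCurv g x) ![l] x =
      1 / 2 * scalarCurv g x * pd l (scalarCurv g) x + ricciGrad g l x := by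
  have h (i k : Fin 4) : covDeriv g (fun a x => ricci g a x * scalarCurv g x) ![i, k, l] x =
      covDeriv g (ricci g) ![i, k, l] x * scalarCurv g x +
        ricci g ![k, l] x * pd i (scalarCurv g) x := by
    have e : (fun a x => ricci g a x * scalarCurv g x) = fun (a : Fin 2 → Fin 4) x =>
        ricci g (a ∘ ![0, 1]) x * scalarField (scalarCurv g) (a ∘ ![]) x := rfl
    rw [e]
    refine (covDeriv_mul hg.isOpen hg.smoothOn_ricci (S := scalarField (scalarCurv g))
      (fun _ => hg.contDiffOn_scalarCurv) hx (N := 2) ![0, 1] ![] (by decide) i ![k, l]).trans ?_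
    rw [covDeriv_scalarField]
    simp [fin_cons_eq_vecCons, comp_vecCons', comp_vecEmpty', scalarField, grad]
  rw [divergence_eq_contr, contr_vecCons]
  simp only [h, mul_add, Finset.sum_add_distrib, ← mul_assoc, ← Finset.sum_mul]
  rw [hg.div_ricci hx, ricciGrad]
  congr 1
  · ring
  · refine Finset.sum_congr rfl fun p _ => ?_
    rw [Finset.sum_mul]
    exact Finset.sum_congr rfl fun q _ => by rw [hg.ricci_symm hx l q]; ring

lemma ricciSq_symm (hx : x ∈ U) (k l : Fin 4) : ricciSq g ![k, l] x = ricciSq g ![l, k] x := by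
  rw [ricciSq_apply, ricciSq_apply, hg.sum_inv_comm hx]
  simp only [mul_comm (ricci g ![k, _] x)]

lemma riemannRicci_symm (hx : x ∈ U) (k l : Fin 4) :
    riemannRicci g ![k, l] x = riemannRicci g ![l, k] x := by
  rw [riemannRicci_apply, riemannRicci_apply]
  simp only [Finset.mul_sum]
  simp only [← Fintype.sum_prod_type']
  refine Fintype.sum_equiv (Equiv.mk (fun z : Fin 4 × Fin 4 × Fin 4 × Fin 4 =>
    (z.2.2.1, z.2.2.2, z.1, z.2.1)) (fun z => (z.2.2.1, z.2.2.2, z.1, z.2.1))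
    (fun _ => rfl) (fun _ => rfl)) _ _ fun z => ?_
  simp only [Equiv.coe_fn_mk]
  rw [hg.ricci_symm hx z.2.1, hg.riemann_pair hx z.2.2.1 l, hg.riemann_swap_left hx k,
    riemann_swap_right g z.1 k]
  ring

/-- Not visible from the definition: symmetry comes from the commuted formula, each term of which is
symmetric. It merges W_{kl} + W_{lk} into 2W_{kl} in the divergence of H. -/
lemma divCovDerivRicci_symm (hx : x ∈ U) (k l : Fin 4) :
    divCovDerivRicci g ![k, l] x = divCovDerivRicci g ![l, k] x := by
  rw [hg.divCovDerivRicci_eq hx, hg.divCovDerivRicci_eq hx, hg.hessScalarCurv_symm hx,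
    hg.ricciSq_symm hx, hg.riemannRicci_symm hx]

/-- The tensor `Φ` in terms of the Ricci tensor. -/
lemma phi_eq (hx : x ∈ U) (a : Fin 2 → Fin 4) : phi g a x = metric g a x * phiTrace g x +
    (4 * riemannRicci g a x + (2 * ricciSq g a x + 4 / 3 * (ricci g a x * scalarCurv g x))) := by
  rw [eq_vec_two a]
  generalize a 0 = k
  generalize a 1 = l
  set R := scalarCurv g x with hR
  have hU (m j : Fin 4) : einsteinUp g m j x =
      ∑ p, ∑ q, (g x)⁻¹ m p * (g x)⁻¹ j q * ricci g ![p, q] x - 1 / 2 * R * (g x)⁻¹ m j := by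
    have : ∑ p, ∑ q, (g x)⁻¹ m p * (g x)⁻¹ j q * g x p q = (g x)⁻¹ m j := by
      rw [Finset.sum_comm]
      have (q : Fin 4) : ∑ p, (g x)⁻¹ m p * (g x)⁻¹ j q * g x p q =
          (g x)⁻¹ j q * ∑ p, (g x)⁻¹ m p * g x p q := by
        rw [Finset.mul_sum]
        exact Finset.sum_congr rfl fun _ _ => by ring
      simp only [this, hg.inv_mul hx]
      simp [hg.inv_symm hx j m]
    rw [← this]
    simp only [einsteinUp, einstein, Finset.mul_sum, ← Finset.sum_sub_distrib]
    exact Finset.sum_congr rfl fun p _ => Finset.sum_congr rfl fun q _ => by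
      simp only [Matrix.cons_val_zero, Matrix.cons_val_one]; ring
  have htr : ∑ p, ∑ q, (g x)⁻¹ p q * ricci g ![p, q] x = R := rfl
  -- Dimension four enters here: in G_{pq}G^{pq} the trace terms are -R² + ¼·4·R² = 0, so the norms
  -- of G and Ric agree.
  have hgg : ∑ p, ∑ q, g x p q * (g x)⁻¹ p q = 4 := by
    have (p : Fin 4) : ∑ q, g x p q * (g x)⁻¹ p q = 1 := by
      have h := hg.mul_inv hx p p
      simp only [hg.inv_symm hx _ p, if_true] at h
      exact h
    simp [this]
  have hgR : ∑ m, ∑ j, g x m j * ∑ p, ∑ q, (g x)⁻¹ m p * (g x)⁻¹ j q * ricci g ![p, q] x = R := by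
    have e (m : Fin 4) : ∑ j, g x m j * ∑ p, ∑ q, (g x)⁻¹ m p * (g x)⁻¹ j q * ricci g ![p, q] x =
        ∑ p, (g x)⁻¹ m p * ricci g ![p, m] x := by
      have (j : Fin 4) : g x m j * ∑ p, ∑ q, (g x)⁻¹ m p * (g x)⁻¹ j q * ricci g ![p, q] x =
          ∑ p, ∑ q, (g x m j * (g x)⁻¹ j q) * ((g x)⁻¹ m p * ricci g ![p, q] x) := by
        simp only [Finset.mul_sum]
        exact Finset.sum_congr rfl fun p _ => Finset.sum_congr rfl fun q _ => by ring
      simp only [this]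
      rw [Finset.sum_comm]
      refine Finset.sum_congr rfl fun p _ => ?_
      rw [Finset.sum_comm]
      simp only [← Finset.sum_mul, hg.mul_inv hx]
      simp
    simp only [e, ← htr]
    exact Finset.sum_congr rfl fun m _ => Finset.sum_congr rfl fun p _ => by
      rw [hg.ricci_symm hx]
  have h1 : ∑ p, ∑ q, einstein g ![p, q] x * einsteinUp g p q x = ricciNormSq g x := by
    have e : ∑ p, ∑ q, ricci g ![p, q] x *
        ∑ r, ∑ s, (g x)⁻¹ p r * (g x)⁻¹ q s * ricci g ![r, s] x = ricciNormSq g x := by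
      rw [ricciNormSq_apply]
      simp only [Finset.mul_sum]
      simp only [← Fintype.sum_prod_type']
      refine Fintype.sum_equiv (Equiv.mk (fun z : Fin 4 × Fin 4 × Fin 4 × Fin 4 =>
        (z.1, z.2.2.1, z.2.1, z.2.2.2)) (fun z => (z.1, z.2.2.1, z.2.1, z.2.2.2))
        (fun _ => rfl) (fun _ => rfl)) _ _ fun z => ?_
      simp only [Equiv.coe_fn_mk]
      rw [hg.ricci_symm hx z.2.2.2]
      ring
    have e2 (p q : Fin 4) : einstein g ![p, q] x * einsteinUp g p q x =
        ricci g ![p, q] x * ∑ r, ∑ s, (g x)⁻¹ p r * (g x)⁻¹ q s * ricci g ![r, s] x -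
        1 / 2 * R * ((g x)⁻¹ p q * ricci g ![p, q] x) -
        1 / 2 * R * (g x p q * ∑ r, ∑ s, (g x)⁻¹ p r * (g x)⁻¹ q s * ricci g ![r, s] x) +
        1 / 4 * R ^ 2 * (g x p q * (g x)⁻¹ p q) := by
      rw [hU]
      simp only [einstein, Matrix.cons_val_zero, Matrix.cons_val_one]
      ring
    simp only [e2, Finset.sum_add_distrib, Finset.sum_sub_distrib, ← Finset.mul_sum, e, htr, hgR,
      hgg]
    ring
  have h2 : ∑ j, ∑ m, riemann g j k l m x * einsteinUp g m j x =
      riemannRicci g ![k, l] x + 1 / 2 * R * ricci g ![k, l] x := by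
    have e : ∑ j, ∑ m, riemann g j k l m x *
        ∑ p, ∑ q, (g x)⁻¹ m p * (g x)⁻¹ j q * ricci g ![p, q] x = riemannRicci g ![k, l] x := by
      rw [riemannRicci_apply]
      simp only [Finset.mul_sum]
      simp only [← Fintype.sum_prod_type']
      refine Fintype.sum_equiv (Equiv.mk (fun z : Fin 4 × Fin 4 × Fin 4 × Fin 4 =>
        (z.1, z.2.2.2, z.2.1, z.2.2.1)) (fun z => (z.1, z.2.2.1, z.2.2.2, z.2.1))
        (fun _ => rfl) (fun _ => rfl)) _ _ fun z => ?_
      simp only [Equiv.coe_fn_mk]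
      ring
    have e3 : ∑ j, ∑ m, (g x)⁻¹ m j * riemann g j k l m x = -ricci g ![k, l] x := by
      rw [← hg.contr_riemann hx, Finset.sum_comm]
      refine Finset.sum_congr rfl fun m _ => Finset.sum_congr rfl fun j _ => ?_
      rw [hg.riemann_swap_left hx, riemann_swap_right g k j, neg_neg]
    have e2 (j m : Fin 4) : riemann g j k l m x * einsteinUp g m j x =
        riemann g j k l m x * ∑ p, ∑ q, (g x)⁻¹ m p * (g x)⁻¹ j q * ricci g ![p, q] x -
        1 / 2 * R * ((g x)⁻¹ m j * riemann g j k l m x) := by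
      rw [hU]
      ring
    simp only [e2, Finset.sum_sub_distrib, ← Finset.mul_sum, e, e3]
    ring
  have h3 : ∑ m, einstein g ![k, m] x * einsteinMixed g l m x =
      ricciSq g ![k, l] x - R * ricci g ![k, l] x + 1 / 4 * R ^ 2 * g x k l := by
    have e1 : ∑ m, ∑ p, (g x)⁻¹ m p * (ricci g ![l, p] x * g x k m) = ricci g ![k, l] x := by
      rw [hg.sum_inv_comm hx, hg.ricci_symm hx]
      rw [← hg.sum_inv_metric_right hx k fun p => ricci g ![l, p] x]
      exact Finset.sum_congr rfl fun m _ => Finset.sum_congr rfl fun p _ => by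
        rw [hg.symm hx k]; ring
    have e2 : ∑ m, ∑ p, (g x)⁻¹ m p * (ricci g ![k, m] x * g x l p) = ricci g ![k, l] x := by
      rw [← hg.sum_inv_metric_right hx l fun p => ricci g ![k, p] x]
      exact Finset.sum_congr rfl fun m _ => Finset.sum_congr rfl fun p _ => by
        rw [hg.symm hx l]; ring
    have e3 : ∑ m, ∑ p, (g x)⁻¹ m p * (g x k m * g x l p) = g x k l := by
      rw [← hg.sum_inv_metric_right hx l fun p => g x k p]
      exact Finset.sum_congr rfl fun m _ => Finset.sum_congr rfl fun p _ => by
        rw [hg.symm hx l]; ring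
    have e4 (m : Fin 4) : einstein g ![k, m] x * einsteinMixed g l m x =
        ∑ p, ((g x)⁻¹ m p * (ricci g ![k, m] x * ricci g ![l, p] x) -
          1 / 2 * R * ((g x)⁻¹ m p * (ricci g ![l, p] x * g x k m)) -
          1 / 2 * R * ((g x)⁻¹ m p * (ricci g ![k, m] x * g x l p)) +
          1 / 4 * R ^ 2 * ((g x)⁻¹ m p * (g x k m * g x l p))) := by
      rw [einsteinMixed, Finset.mul_sum]
      refine Finset.sum_congr rfl fun p _ => ?_
      simp only [einstein, Matrix.cons_val_zero, Matrix.cons_val_one]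
      ring
    simp only [e4, Finset.sum_add_distrib, Finset.sum_sub_distrib, ← Finset.mul_sum, e1, e2, e3,
      ricciSq_apply]
    ring
  -- Collecting terms: R²g gets -1/6 + 1/2 - 2/3 = -1/3, and R Ric gets 2 - 2 + 4/3 = 4/3.
  simp only [phi, metric, Matrix.cons_val_zero, Matrix.cons_val_one, h1, h2, h3, phiTrace]
  simp only [einstein, Matrix.cons_val_zero, Matrix.cons_val_one, ← hR]
  ring

lemma smoothOn_metric_mul_phiTrace : SmoothOn (fun a x => metric g a x * phiTrace g x) U :=
  hg.smoothOn_metric.mul_fun hg.contDiffOn_phiTrace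

lemma smoothOn_ricci_mul : SmoothOn (fun a x => ricci g a x * scalarCurv g x) U :=
  hg.smoothOn_ricci.mul_fun hg.contDiffOn_scalarCurv

lemma smoothOn_phi : SmoothOn (phi g) U := fun a =>
  ((hg.smoothOn_metric_mul_phiTrace.add ((hg.smoothOn_riemannRicci.const_mul 4).add
    ((hg.smoothOn_ricciSq.const_mul 2).add (hg.smoothOn_ricci_mul.const_mul (4 / 3))))) a).congr
      fun _ hx => hg.phi_eq hx a

lemma phi_symm (hx : x ∈ U) (k l : Fin 4) : phi g ![k, l] x = phi g ![l, k] x := by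
  rw [hg.phi_eq hx, hg.phi_eq hx, hg.riemannRicci_symm hx, hg.ricciSq_symm hx, hg.ricci_symm hx]
  simp [metric, hg.symm hx k l]

/-- Normal form in the five basic covectors. The terms R∇_lR cancel, -2/3 from the trace part
against (4/3)·½; the other composite coefficients are 7/3 = 1 + 4/3, -3 = 1 - 4 and 6 = 4 + 2. -/
lemma divergence_phi (hx : x ∈ U) (l : Fin 4) : divergence g (phi g) ![l] x =
    1 / 2 * pd l (laplacian g (scalarCurv g)) x + 7 / 3 * ricciGrad g l x -
      3 * ricciCovDerivRicci g l x + 6 * ricciDerivRicci g l x +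
      4 * riemannDerivRicci g l x := by
  have hU := hg.isOpen
  have s1 := hg.smoothOn_riemannRicci.const_mul 4
  have s2 := hg.smoothOn_ricciSq.const_mul 2
  have s3 := hg.smoothOn_ricci_mul.const_mul (4 / 3)
  rw [divergence_congr hU (fun a y hy => hg.phi_eq hy a) hx,
    divergence_add hU hg.smoothOn_metric_mul_phiTrace (s1.add (s2.add s3)) hx,
    divergence_add hU s1 (s2.add s3) hx, divergence_add hU s2 s3 hx,
    divergence_const_mul hU hg.smoothOn_riemannRicci _ hx,
    divergence_const_mul hU hg.smoothOn_ricciSq _ hx,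
    divergence_const_mul hU hg.smoothOn_ricci_mul _ hx,
    hg.divergence_metric_mul hg.contDiffOn_phiTrace hx, hg.divergence_ricci_mul hx,
    hg.div_riemannRicci hx, hg.div_ricciSq hx, hg.pd_phiTrace hx]
  ring

end IsMetricOn

/-! ### The double divergence of Harada's tensor, conserved currents and the Einstein case. -/

namespace IsMetricOn

variable {g : MetricField} {U : Set Coord} (hg : IsMetricOn g U) {x : Coord}
include hg

/-- H is a combination of permuted copies of ∇Ric and g ⊗ dR. Differentiation commutes with the
permutations and passes through g, so the trace leaves the rough Laplacian of Ric, two copies of W,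
and Hessian terms; no curvature identity is needed beyond the symmetry of Ric. -/
lemma divergence_harada (hx : x ∈ U) (k l : Fin 4) : divergence g (harada g) ![k, l] x =
    contr g (covDeriv g (covDeriv g (ricci g))) ![k, l] x + divCovDerivRicci g ![k, l] x +
      divCovDerivRicci g ![l, k] x - 1 / 3 * (g x k l * laplacian g (scalarCurv g) x +
        hessScalarCurv g ![k, l] x + hessScalarCurv g ![l, k] x) := by
  have hU := hg.isOpen
  have hT : SmoothOn (covDeriv g (ricci g)) U := hg.smoothOn_covDeriv hg.smoothOn_ricci
  have hdR := hg.smoothOn_grad_scalarCurv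
  have hm := hg.smoothOn_metric
  let P (σ : Fin 3 → Fin 3) : TensorField 3 := fun a x => covDeriv g (ricci g) (a ∘ σ) x
  let K (σ : Fin 2 → Fin 3) (τ : Fin 1 → Fin 3) : TensorField 3 :=
    fun a x => metric g (a ∘ σ) x * grad (scalarCurv g) (a ∘ τ) x
  have hP (σ) : SmoothOn (P σ) U := fun _ => hT _
  have hK (σ τ) : SmoothOn (K σ τ) U := fun _ => (hm _).mul (hdR _)
  have e : harada g = fun a x => (P ![0, 1, 2] a x + (P ![1, 2, 0] a x + P ![2, 0, 1] a x)) +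
      (-(1 / 3)) * (K ![1, 2] ![0] a x + (K ![2, 0] ![1] a x + K ![0, 1] ![2] a x)) := by
    funext a x
    simp only [harada, P, K, comp_vecCons', comp_vecEmpty', metric, Matrix.cons_val_zero,
      Matrix.cons_val_one]
    ring
  have hKc (i q : Fin 4) (σ : Fin 2 → Fin 3) (τ : Fin 1 → Fin 3)
      (h : Function.Bijective (Sum.elim σ τ)) : covDeriv g (K σ τ) ![i, q, k, l] x =
      metric g (![q, k, l] ∘ σ) x *
        hessScalarCurv g (Matrix.vecCons i (![q, k, l] ∘ τ)) x := by
    refine (covDeriv_mul hU hm hdR hx σ τ h i ![q, k, l]).trans ?_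
    rw [hg.covDeriv_metric hx, zero_mul, zero_add]
    rfl
  have hPc (i q : Fin 4) (σ : Fin 3 → Fin 3) (h : Function.Bijective σ) :
      covDeriv g (P σ) ![i, q, k, l] x =
        covDeriv g (covDeriv g (ricci g)) (Matrix.vecCons i (![q, k, l] ∘ σ)) x :=
    covDeriv_perm (n := 3) _ σ h i ![q, k, l]
  have hc (i q : Fin 4) : covDeriv g (harada g) ![i, q, k, l] x =
      covDeriv g (covDeriv g (ricci g)) ![i, q, k, l] x +
      covDeriv g (covDeriv g (ricci g)) ![i, k, q, l] x +
      covDeriv g (covDeriv g (ricci g)) ![i, l, q, k] x -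
      1 / 3 * (g x k l * hessScalarCurv g ![i, q] x +
        g x q l * hessScalarCurv g ![i, k] x + g x q k * hessScalarCurv g ![i, l] x) := by
    -- The cyclic order in H puts the traced index last in this term; symmetry of Ric brings it to
    -- the form appearing in W.
    have hsw : covDeriv g (covDeriv g (ricci g)) ![i, k, l, q] x =
        covDeriv g (covDeriv g (ricci g)) ![i, k, q, l] x := by
      refine (covDeriv_of_symm (n := 3) hU hT 1 ![0, 2, 1] (by decide) (fun a y hy => ?_) hx i
        ![k, l, q]).trans ?_
      · have : a = ![a 0, a 1, a 2] := by ext j; fin_cases j <;> rfl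
        rw [one_mul, this, hg.covDeriv_ricci_symm hy]
        simp [comp_vecCons', comp_vecEmpty']
      · simp [comp_vecCons', comp_vecEmpty']
    rw [e, covDeriv_add hU ((hP _).add ((hP _).add (hP _)))
        (((hK _ _).add ((hK _ _).add (hK _ _))).const_mul _) hx,
      covDeriv_add hU (hP _) ((hP _).add (hP _)) hx, covDeriv_add hU (hP _) (hP _) hx,
      covDeriv_const_mul hU ((hK _ _).add ((hK _ _).add (hK _ _))) _ hx,
      covDeriv_add hU (hK _ _) ((hK _ _).add (hK _ _)) hx, covDeriv_add hU (hK _ _) (hK _ _) hx,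
      hPc _ _ _ (by decide), hPc _ _ _ (by decide), hPc _ _ _ (by decide),
      hKc _ _ _ _ (by decide), hKc _ _ _ _ (by decide), hKc _ _ _ _ (by decide)]
    simp only [comp_vecCons', comp_vecEmpty', Matrix.cons_val_zero, Matrix.cons_val_one,
      Matrix.cons_val, metric, hsw, hg.symm hx l q]
    ring
  have hlap : ∑ i, ∑ q, (g x)⁻¹ i q * hessScalarCurv g ![i, q] x =
      laplacian g (scalarCurv g) x := rfl
  have h1 (k l : Fin 4) : ∑ i, ∑ q, (g x)⁻¹ i q * (g x q l * hessScalarCurv g ![i, k] x) =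
      hessScalarCurv g ![l, k] x :=
    hg.sum_inv_metric_right hx l fun i => hessScalarCurv g ![i, k] x
  rw [divergence_eq_contr, contr_vecCons, contr_vecCons, divCovDerivRicci_apply,
    divCovDerivRicci_apply]
  have h2 (i q : Fin 4) : (g x)⁻¹ i q * covDeriv g (harada g) ![i, q, k, l] x =
      (g x)⁻¹ i q * covDeriv g (covDeriv g (ricci g)) ![i, q, k, l] x +
      (g x)⁻¹ i q * covDeriv g (covDeriv g (ricci g)) ![i, k, q, l] x +
      (g x)⁻¹ i q * covDeriv g (covDeriv g (ricci g)) ![i, l, q, k] x -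
      1 / 3 * (g x k l * ((g x)⁻¹ i q * hessScalarCurv g ![i, q] x) +
        (g x)⁻¹ i q * (g x q l * hessScalarCurv g ![i, k] x) +
        (g x)⁻¹ i q * (g x q k * hessScalarCurv g ![i, l] x)) := by
    rw [hc]
    ring
  simp only [h2, Finset.sum_add_distrib, Finset.sum_sub_distrib, ← Finset.mul_sum, hlap, h1]
  ring

/-- `∇^k ∇^j H_{jkl} = ∇^k Φ_{kl}`. -/
theorem divergence_divergence_harada (hx : x ∈ U) (l : Fin 4) :
    divergence g (divergence g (harada g)) ![l] x = divergence g (phi g) ![l] x := by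
  have hU := hg.isOpen
  have sB : SmoothOn (contr g (covDeriv g (covDeriv g (ricci g)))) U :=
    hg.smoothOn_contr hg.smoothOn_covDeriv_covDeriv_ricci
  have sW := hg.smoothOn_divCovDerivRicci
  have sH := hg.smoothOn_hessScalarCurv
  have sL : SmoothOn (fun a x => metric g a x * laplacian g (scalarCurv g) x) U :=
    hg.smoothOn_metric.mul_fun hg.contDiffOn_laplacian
  have hW : divergence g (divCovDerivRicci g) ![l] x =
      1 / 2 * divergence g (hessScalarCurv g) ![l] x + (divergence g (ricciSq g) ![l] x +
        divergence g (riemannRicci g) ![l] x) := by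
    rw [divergence_congr hU (S := fun a x => 1 / 2 * hessScalarCurv g a x +
        (ricciSq g a x + riemannRicci g a x)) (fun a y hy => ?_) hx,
      divergence_add hU (sH.const_mul _) (hg.smoothOn_ricciSq.add hg.smoothOn_riemannRicci) hx,
      divergence_const_mul hU sH _ hx,
      divergence_add hU hg.smoothOn_ricciSq hg.smoothOn_riemannRicci hx]
    rw [eq_vec_two a, hg.divCovDerivRicci_eq hy, add_assoc]
  have hH (a : Fin 2 → Fin 4) (y : Coord) (hy : y ∈ U) : divergence g (harada g) a y =
      contr g (covDeriv g (covDeriv g (ricci g))) a y + (2 * divCovDerivRicci g a y +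
        (-(1 / 3) * (metric g a y * laplacian g (scalarCurv g) y) +
          -(2 / 3) * hessScalarCurv g a y)) := by
    rw [eq_vec_two a, hg.divergence_harada hy, hg.divCovDerivRicci_symm hy (a 1),
      hg.hessScalarCurv_symm hy (a 1)]
    simp only [metric, Matrix.cons_val_zero, Matrix.cons_val_one]
    ring
  -- The Laplacian of Ric contributes a third ∇^kW_{kl}. Since each contains ½ of the divergence of
  -- the Hessian, that divergence has coefficient 3/2 - 2/3 = 5/6; then ∇_l∇²R gets 5/6 - 1/3 = 1/2
  -- and R_{lk}∇^kR gets 5/6 + 3/2 = 7/3.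
  rw [divergence_congr hU hH hx,
    divergence_add hU sB ((sW.const_mul _).add ((sL.const_mul _).add (sH.const_mul _))) hx,
    divergence_add hU (sW.const_mul _) ((sL.const_mul _).add (sH.const_mul _)) hx,
    divergence_add hU (sL.const_mul _) (sH.const_mul _) hx, divergence_const_mul hU sW _ hx,
    divergence_const_mul hU sL _ hx, divergence_const_mul hU sH _ hx,
    hg.divergence_metric_mul hg.contDiffOn_laplacian hx, hg.div_laplacian_ricci hx, hW,
    hg.div_hessScalarCurv hx, hg.div_ricciSq hx, hg.div_riemannRicci hx, hg.divergence_phi hx]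
  ring

/-- `Φ` is divergence free for vacuum solutions. -/
theorem divergence_phi_eq_zero (h : ∀ y ∈ U, ∀ j k l : Fin 4, harada g ![j, k, l] y = 0)
    (hx : x ∈ U) (l : Fin 4) : divergence g (phi g) ![l] x = 0 := by
  rw [← hg.divergence_divergence_harada hx]
  rw [divergence_congr hg.isOpen (S := fun _ _ => 0) (fun a y hy => ?_) hx, divergence_zero]
  rw [divergence_congr hg.isOpen (S := fun _ _ => 0) (fun b z hz => ?_) hy, divergence_zero]
  have : b = ![b 0, b 1, b 2] := by ext j; fin_cases j <;> rfl
  rw [this]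
  exact h z hz _ _ _

/-- A divergence-free `Φ` gives a conserved current for each Killing vector field. -/
theorem divergence_current {ξ : Fin 4 → Coord → ℝ} (hξ : ∀ i, ContDiffOn ℝ ∞ (ξ i) U)
    (hK : ∀ y ∈ U, ∀ i j : Fin 4, covDeriv g (lower g ξ) ![i, j] y +
      covDeriv g (lower g ξ) ![j, i] y = 0)
    (hx : x ∈ U) (hdiv : ∀ l, divergence g (phi g) ![l] x = 0) :
    divergence g (current g ξ) ![] x = 0 := by
  have sξ : SmoothOn (lower g ξ) U := fun a =>
    ContDiffOn.sum fun l _ => (hg.contDiffOn _ _).mul (hξ l)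
  have sP : SmoothOn (fun (a : Fin 3 → Fin 4) x =>
      phi g (a ∘ ![2, 0]) x * lower g ξ (a ∘ ![1]) x) U :=
    fun _ => (hg.smoothOn_phi _).mul (sξ _)
  -- The Killing equation concerns lowered components, so the current is rewritten as
  -- Φ_{kl}g^{lm}ξ_m, with slots ordered (l, m, k).
  have e (a : Fin 1 → Fin 4) (y : Coord) (hy : y ∈ U) : current g ξ a y =
      contr g (fun a x => phi g (a ∘ ![2, 0]) x * lower g ξ (a ∘ ![1]) x) a y := by
    rw [eq_vec_one a, contr_vecCons]
    simp only [current, comp_vecCons', comp_vecEmpty', Matrix.cons_val_zero, Matrix.cons_val_one,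
      Matrix.cons_val]
    refine Finset.sum_congr rfl fun l _ => ?_
    have : _ = ξ l y := hg.inv_mul_metric_mul hy l fun j => ξ j y
    rw [← this, Finset.mul_sum]
    exact Finset.sum_congr rfl fun m _ => by simp only [lower, Matrix.cons_val_zero]; ring
  have hc (i k : Fin 4) : covDeriv g (current g ξ) ![i, k] x = ∑ l, ∑ m, (g x)⁻¹ l m *
      (covDeriv g (phi g) ![i, k, l] x * lower g ξ ![m] x +
        phi g ![k, l] x * covDeriv g (lower g ξ) ![i, m] x) := by
    rw [covDeriv_congr hg.isOpen e hx]
    refine (hg.covDeriv_contr sP hx i ![k]).trans ?_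
    simp only [covDeriv_mul hg.isOpen hg.smoothOn_phi sξ hx (N := 3) ![2, 0] ![1] (by decide)]
    simp [fin_cons_eq_vecCons, comp_vecCons', comp_vecEmpty']
  have h1 : ∑ i, ∑ k, (g x)⁻¹ i k * ∑ l, ∑ m, (g x)⁻¹ l m *
      (covDeriv g (phi g) ![i, k, l] x * lower g ξ ![m] x) = 0 := by
    have : ∑ i, ∑ k, (g x)⁻¹ i k * ∑ l, ∑ m, (g x)⁻¹ l m *
        (covDeriv g (phi g) ![i, k, l] x * lower g ξ ![m] x) =
        ∑ l, ∑ m, (g x)⁻¹ l m * (divergence g (phi g) ![l] x * lower g ξ ![m] x) := by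
      rw [divergence_eq_contr]
      simp only [contr_vecCons, Finset.mul_sum, Finset.sum_mul]
      simp only [← Fintype.sum_prod_type']
      refine Fintype.sum_equiv (Equiv.mk (fun z : Fin 4 × Fin 4 × Fin 4 × Fin 4 =>
        (z.2.2.1, z.2.2.2, z.1, z.2.1)) (fun z => (z.2.2.1, z.2.2.2, z.1, z.2.1))
        (fun _ => rfl) (fun _ => rfl)) _ _ fun z => ?_
      simp only [Equiv.coe_fn_mk]
      ring
    rw [this]
    simp [hdiv]
  -- Symmetric against antisymmetric: reversing the order of the four dummy indices shows that
  -- Φ_{kl}∇^kξ^l equals its own negative.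
  have h2 : ∑ i, ∑ k, (g x)⁻¹ i k * ∑ l, ∑ m, (g x)⁻¹ l m *
      (phi g ![k, l] x * covDeriv g (lower g ξ) ![i, m] x) =
      -∑ i, ∑ k, (g x)⁻¹ i k * ∑ l, ∑ m, (g x)⁻¹ l m *
      (phi g ![k, l] x * covDeriv g (lower g ξ) ![i, m] x) := by
    simp only [Finset.mul_sum, ← Finset.sum_neg_distrib]
    simp only [← Fintype.sum_prod_type']
    refine Fintype.sum_equiv (Equiv.mk (fun z : Fin 4 × Fin 4 × Fin 4 × Fin 4 =>
      (z.2.2.2, z.2.2.1, z.2.1, z.1)) (fun z => (z.2.2.2, z.2.2.1, z.2.1, z.1))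
      (fun _ => rfl) (fun _ => rfl)) _ _ fun z => ?_
    simp only [Equiv.coe_fn_mk]
    rw [hg.inv_symm hx z.2.2.2, hg.inv_symm hx z.2.1, hg.phi_symm hx z.2.1,
      eq_neg_of_add_eq_zero_left (hK x hx z.1 z.2.2.2)]
    ring
  rw [divergence_eq_contr, contr_vecCons]
  simp only [Matrix.vecCons] at hc ⊢
  simp only [hc, mul_add, Finset.sum_add_distrib]
  simp only [Matrix.vecCons] at h1 h2
  rw [h1]
  linarith

/-- `Φ` vanishes for Einstein metrics. -/
theorem phi_eq_zero_of_einstein (h : ∀ y ∈ U, ∀ j m : Fin 4,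
    ricci g ![j, m] y = (1 / 4 : ℝ) * scalarCurv g y * g y j m) (hx : x ∈ U) (k l : Fin 4) :
    phi g ![k, l] x = 0 := by
  -- The divergence of Ric = ¼Rg is ¼∇_lR, while the Bianchi identity gives ½∇_lR, so ∇R = 0
  -- throughout U and the Laplacian of R vanishes.
  have hdR (y : Coord) (hy : y ∈ U) (l : Fin 4) : pd l (scalarCurv g) y = 0 := by
    have sR : SmoothOn (fun a x => metric g a x * scalarCurv g x) U :=
      hg.smoothOn_metric.mul_fun hg.contDiffOn_scalarCurv
    have h1 : divergence g (ricci g) ![l] y = 1 / 2 * pd l (scalarCurv g) y := hg.div_ricci hy l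
    rw [divergence_congr hg.isOpen
      (S := fun a x => 1 / 4 * (metric g a x * scalarCurv g x)) (fun a z hz => ?_) hy,
      divergence_const_mul hg.isOpen sR _ hy,
      hg.divergence_metric_mul hg.contDiffOn_scalarCurv hy] at h1
    · linarith
    · rw [eq_vec_two a, h z hz]
      simp only [metric, Matrix.cons_val_zero, Matrix.cons_val_one]
      ring
  have hlap : laplacian g (scalarCurv g) x = 0 := by
    rw [laplacian, divergence_congr hg.isOpen (T := grad (scalarCurv g)) (S := fun _ _ => 0)
      (fun a y hy => hdR y hy _) hx, divergence_zero]
  set R := scalarCurv g x with hR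
  have hY : ricciSq g ![k, l] x = 1 / 16 * R ^ 2 * g x k l := by
    rw [ricciSq_apply, ← hg.sum_inv_metric_right hx l fun p => g x k p]
    simp only [Finset.mul_sum, h x hx, ← hR]
    exact Finset.sum_congr rfl fun p _ => Finset.sum_congr rfl fun q _ => by
      rw [hg.symm hx l q]; ring
  have hin (p : Fin 4) (F : Fin 4 → ℝ) : ∑ q, (g x)⁻¹ p q * ∑ r, ∑ s, (g x)⁻¹ r s *
      (F r * (1 / 4 * R * g x s q)) = 1 / 4 * R * ∑ r, (g x)⁻¹ p r * F r := by
    rw [Finset.mul_sum]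
    refine Finset.sum_congr rfl fun q _ => ?_
    have h3 := hg.sum_inv_metric_right hx q F
    rw [← h3]
    simp only [Finset.mul_sum]
    exact Finset.sum_congr rfl fun r _ => Finset.sum_congr rfl fun s _ => by ring
  have hX : riemannRicci g ![k, l] x = -(1 / 16) * R ^ 2 * g x k l := by
    rw [riemannRicci_apply]
    simp only [h x hx, ← hR, hin]
    have : ∑ p, ∑ r, (g x)⁻¹ p r * riemann g p k l r x = -ricci g ![k, l] x := by
      rw [← hg.contr_riemann hx, hg.sum_inv_comm hx]
      refine Finset.sum_congr rfl fun p _ => Finset.sum_congr rfl fun r _ => ?_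
      rw [hg.riemann_swap_left hx, riemann_swap_right g k, neg_neg]
    rw [← Finset.mul_sum, this, h x hx, ← hR]
    ring
  have hN : ricciNormSq g x = 1 / 4 * R ^ 2 := by
    rw [ricciNormSq_apply]
    have htr : ∑ p, ∑ q, (g x)⁻¹ p q * ricci g ![p, q] x = R := rfl
    simp only [h x hx, ← hR] at htr ⊢
    simp only [hin]
    rw [← Finset.mul_sum, htr]
    ring
  -- The coefficient of R²g is 1/8 - 1/3 - 1/4 + 1/8 + 1/3 = 0.
  rw [hg.phi_eq hx, hY, hX, h x hx, phiTrace, hN, hlap]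
  simp only [metric, Matrix.cons_val_zero, Matrix.cons_val_one, ← hR]
  ring

end IsMetricOn

/-! ### Metrics and vector fields in a chart -/

section ChartComponents

attribute [local instance 2000] chartedSpaceSelf

variable {M : Type*} [TopologicalSpace M] [ChartedSpace Coord M]
  {e : OpenPartialHomeomorph M Coord}

lemma mdifferentiable_of_mem_maximalAtlas (he : e ∈ IsManifold.maximalAtlas (𝓡 4) ∞ M) :
    e.MDifferentiable (𝓡 4) (𝓡 4) :=
  ⟨(contMDiffOn_of_mem_maximalAtlas he).mdifferentiableOn (by simp),
    (contMDiffOn_symm_of_mem_maximalAtlas he).mdifferentiableOn (by simp)⟩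

lemma coordVec_sum (v : Fin 4 → ℝ) (x : Coord) :
    mfderiv (𝓡 4) (𝓡 4) e.symm x (WithLp.toLp 2 v : Coord) = ∑ j, v j • coordVec e j x := by
  have h : (WithLp.toLp 2 v : Coord) = ∑ j, v j • (EuclideanSpace.single j (1 : ℝ) : Coord) := by
    ext k
    simp [Pi.single_apply]
  rw [h]
  exact (map_sum (mfderiv (𝓡 4) (𝓡 4) e.symm x) _ _).trans
    (Finset.sum_congr rfl fun j _ => map_smul _ _ _)

variable [IsManifold (𝓡 4) ∞ M]

/-- The coordinate field is the image of a constant section under the tangent map of `e.symm`. -/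
lemma contMDiffOn_coordVec (he : e ∈ IsManifold.maximalAtlas (𝓡 4) ∞ M) (i : Fin 4) :
    ContMDiffOn (𝓡 4) (𝓡 4).tangent ∞
      (fun x => (⟨e.symm x, coordVec e i x⟩ : TangentBundle (𝓡 4) M)) e.target := by
  have h1 := (contMDiffOn_symm_of_mem_maximalAtlas he).contMDiffOn_tangentMapWithin (m := ∞)
    (by simp) e.open_target.uniqueMDiffOn
  have h2 : ContMDiff (𝓡 4) (𝓡 4).tangent ∞ (fun x : Coord =>
      (⟨x, (EuclideanSpace.single i (1 : ℝ) : Coord)⟩ : TangentBundle (𝓡 4) Coord)) :=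
    contMDiff_vectorSpace_iff_contDiff.2 contDiff_const
  refine (h1.comp h2.contMDiffOn fun x hx => hx).congr fun x hx => ?_
  simp only [Function.comp_apply, tangentMapWithin, coordVec]
  rw [mfderivWithin_of_isOpen e.open_target hx]

/-- The tangent map of `e` carries ξ along `e.symm` to a smooth section over a vector space, where
smoothness of the section is smoothness of its vector part. -/
lemma contDiffOn_vecComp {ξ : ∀ p : M, TangentSpace (𝓡 4) p}
    (hξ : ContMDiff (𝓡 4) (𝓡 4).tangent ∞ (fun p => (⟨p, ξ p⟩ : TangentBundle (𝓡 4) M)))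
    (he : e ∈ IsManifold.maximalAtlas (𝓡 4) ∞ M) (i : Fin 4) :
    ContDiffOn ℝ ∞ (vecComp ξ e i) e.target := by
  have h1 := (contMDiffOn_of_mem_maximalAtlas he).contMDiffOn_tangentMapWithin (m := ∞)
    (by simp) e.open_source.uniqueMDiffOn
  have h2 := h1.comp (hξ.comp_contMDiffOn (contMDiffOn_symm_of_mem_maximalAtlas he))
    fun x hx => e.map_target hx
  have h3 : ContMDiffOn (𝓡 4) (𝓡 4).tangent ∞ (fun x : Coord =>
      (⟨x, (mfderiv (𝓡 4) (𝓡 4) e (e.symm x) (ξ (e.symm x)) : Coord)⟩ :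
        TangentBundle (𝓡 4) Coord)) e.target := by
    refine h2.congr fun x hx => ?_
    simp only [Function.comp_apply, tangentMapWithin]
    rw [mfderivWithin_of_isOpen e.open_source (e.map_target hx), e.right_inv hx]
    rfl
  have h4 : ContDiffOn ℝ ∞ (fun x : Coord =>
      (mfderiv (𝓡 4) (𝓡 4) e (e.symm x) (ξ (e.symm x)) : Coord)) e.target :=
    contMDiffOn_vectorSpace_iff_contDiffOn.1 h3
  exact (EuclideanSpace.proj (𝕜 := ℝ) i).contDiff.comp_contDiffOn h4

namespace PseudoRiemannianMetric

/-- A smooth bilinear bundle map, pulled back along `e.symm`, is evaluated on two smooth sections.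
-/
lemma contDiffOn_comp (g : PseudoRiemannianMetric M)
    (he : e ∈ IsManifold.maximalAtlas (𝓡 4) ∞ M) (i j : Fin 4) :
    ContDiffOn ℝ ∞ (fun x => g.comp e x i j) e.target := by
  have h : ContMDiffOn (𝓡 4) ((𝓡 4).prod 𝓘(ℝ)) ∞ (fun x => Bundle.TotalSpace.mk' ℝ
      (E := Bundle.Trivial M ℝ) (e.symm x)
      (g.inner (e.symm x) (coordVec e i x) (coordVec e j x))) e.target := by
    apply ContMDiffOn.clm_bundle_apply₂ (F₁ := Coord) (F₂ := Coord)
    · exact g.contMDiff.comp_contMDiffOn (contMDiffOn_symm_of_mem_maximalAtlas he)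
    · exact contMDiffOn_coordVec he i
    · exact contMDiffOn_coordVec he j
  intro x hx
  have := h x hx
  rw [Bundle.contMDiffWithinAt_totalSpace] at this
  exact contMDiffWithinAt_iff_contDiffWithinAt.1 this.2

/-- The components of a metric in a chart form a metric on the target of the chart. -/
lemma isMetricOn_comp (g : PseudoRiemannianMetric M)
    (he : e ∈ IsManifold.maximalAtlas (𝓡 4) ∞ M) : IsMetricOn (g.comp e) e.target where
  isOpen := e.open_target
  contDiffOn := g.contDiffOn_comp he
  symm _ _ _ := g.symm _ _ _
  det_ne_zero {x} hx h0 := by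
    -- A kernel vector v of the Gram matrix yields w = Σ v^j ∂_j orthogonal to every ∂_i, hence to
    -- all tangent vectors because the differential of `e.symm` is onto. Nondegeneracy forces w = 0,
    -- and injectivity of the differential forces v = 0.
    obtain ⟨v, hv, hgv⟩ := Matrix.exists_mulVec_eq_zero_iff.2 h0
    have hbij := (mdifferentiable_of_mem_maximalAtlas he).symm.mfderiv_bijective
      (show x ∈ e.symm.source from hx)
    set L := mfderiv (𝓡 4) (𝓡 4) e.symm x
    set w : TangentSpace (𝓡 4) (e.symm x) := ∑ j, v j • coordVec e j x with hw
    have hi (i : Fin 4) : g.inner (e.symm x) (coordVec e i x) w = 0 := by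
      have := congr_fun hgv i
      rw [hw, map_sum]
      simp only [map_smul, smul_eq_mul]
      rw [← show _ = (0 : ℝ) from this]
      exact Finset.sum_congr rfl fun j _ => mul_comm _ _
    have hw0 : w = 0 := by
      refine g.nondegenerate _ w fun u => ?_
      obtain ⟨u, rfl⟩ := hbij.surjective u
      have hu : L u = ∑ j, (show Coord from u) j • coordVec e j x := coordVec_sum _ x
      rw [hu, map_sum]
      refine Finset.sum_eq_zero fun j _ => ?_
      rw [map_smul, g.symm, hi, smul_zero]
    have : (WithLp.toLp 2 v : Coord) = 0 := hbij.injective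
      ((coordVec_sum v x).trans (hw0.trans (map_zero L).symm))
    exact hv (by simpa using this)

end PseudoRiemannianMetric

end ChartComponents

end CKG

end

/-! ### The theorem on the manifold, chart by chart. -/

theorem mainTheorem1 {M : Type*} [TopologicalSpace M] [ChartedSpace CKG.Coord M]
    [IsManifold (𝓡 4) ∞ M] (g : CKG.PseudoRiemannianMetric M) :
    -- `∇^k ∇^j H_{jkl} = ∇^k Φ_{kl}`
    (∀ e ∈ IsManifold.maximalAtlas (𝓡 4) ∞ M, ∀ x ∈ e.target, ∀ l : Fin 4,
      CKG.divergence (g.comp e) (CKG.divergence (g.comp e) (CKG.harada (g.comp e))) ![l] x =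
        CKG.divergence (g.comp e) (CKG.phi (g.comp e)) ![l] x) ∧
    -- vacuum solutions: `∇^k Φ_{kl} = 0`, and `∇^k (Φ_{kl} ξ^l) = 0` for every Killing vector
    (g.IsVacuumCKG →
      (∀ e ∈ IsManifold.maximalAtlas (𝓡 4) ∞ M, ∀ x ∈ e.target, ∀ l : Fin 4,
        CKG.divergence (g.comp e) (CKG.phi (g.comp e)) ![l] x = 0) ∧
      ∀ ξ : ∀ p : M, TangentSpace (𝓡 4) p, g.IsKilling ξ →
        ∀ e ∈ IsManifold.maximalAtlas (𝓡 4) ∞ M, ∀ x ∈ e.target,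
          CKG.divergence (g.comp e) (CKG.current (g.comp e) (CKG.vecComp ξ e)) ![] x = 0) ∧
    -- Einstein metrics: `Φ_{kl} = 0`
    (g.IsEinstein →
      ∀ e ∈ IsManifold.maximalAtlas (𝓡 4) ∞ M, ∀ x ∈ e.target, ∀ k l : Fin 4,
        CKG.phi (g.comp e) ![k, l] x = 0) := by
  refine ⟨fun e he x hx l => (g.isMetricOn_comp he).divergence_divergence_harada hx l,
    fun hvac => ⟨fun e he x hx l => (g.isMetricOn_comp he).divergence_phi_eq_zero (hvac e he) hx l,
      fun ξ hξ e he x hx => ?_⟩,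
    fun hein e he x hx k l => (g.isMetricOn_comp he).phi_eq_zero_of_einstein (hein e he) hx k l⟩
  have hg := g.isMetricOn_comp he
  exact hg.divergence_current (CKG.contDiffOn_vecComp hξ.contMDiff he) (hξ.killing e he) hx
    fun l => hg.divergence_phi_eq_zero (hvac e he) hx l
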